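/- Let $d\ge 2$ and let $\mathbb T_d$ be the rooted $d$-ary tree with root $\varnothing$ (each vertex has $d$ children). **The frog model $\mathrm{FM}(d,p)$**, $p\in[0,1]$. At time $0$ there is one frog at every vertex; the frog at $\varnothing$ is active and all others are asleep. Active frogs perform independent discrete-time random walks: from $\varnothing$ to a uniformly chosen child, and from any other vertex to its parent with probability $p$ and to each of its children with probability $(1-p)/d$. When an active frog visits the vertex of a sleeping frog, the latter wakes up and starts its own independent walk with the same rules. **The self-similar frog model $\mathrm{SFM}(d,p)$**, $p\in[0,1]$. Frogs are placed and woken up in the same way, but move and die as follows. The frog starting at $\varnothing$ goes to a uniformly chosen child at every step. Any other frog, upon waking, goes up to the parent with probability $p$, and otherwise to a uniformly chosen child. After an upward step, a frog that is at $\varnothing$ is killed; otherwise it goes up again with probability $\frac{p}{p+(1-p)(d-1)/d}$, and else to one of the $d-1$ children from which it does not come, chosen uniformly. After a downward step it goes to a uniformly chosen child. The walks before killing are independent. Moreover, a frog attempting to jump from a vertex down to a child that has already been visited is killed by that jump, and if several frogs attempt to make the first visit to a child at the same time, all but one of them are killed; so each vertex is entered from its parent at most once. Each model is called *recurrent* if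 almost surely there are infinitely many visits to $\varnothing$. **Proposition.** Let $d\ge 2$, $0\le p\le \tfrac12$, and set $$p^\ast=\frac{p(d-1)}{d-(d+1)p}\in[0,1].$$ If $\mathrm{SFM}(d,p^\ast)$ is recurrent, then $\mathrm{FM}(d,p)$ is recurrent. -/

import Mathlib

open MeasureTheory
open scoped ENNReal

/-- Vertices of the rooted `d`-ary tree, encoded by their addresses: `[]` is the root, the children
of `v` are the lists `i :: v` with `i : Fin d`, and the parent of `a :: v` is `v`. -/
abbrev Vertex (d : ℕ) : Type := List (Fin d)

instance (d : ℕ) : MeasurableSpace (Vertex d) := ⊤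

instance (d : ℕ) : DiscreteMeasurableSpace (Vertex d) := ⟨fun _ => trivial⟩

/-! ### Independent random walks, one for each frog -/

/-- The randomness driving all frogs. The walks are Markov chains on a countable state space `S`,
where `step s` is the law of the next state from `s`. For every frog (labelled by the vertex on
which it is placed initially), every `k : ℕ` and every state `s` there is a random state with
law `step s`, all of them independent. -/
noncomputable def randomness (d : ℕ) {S : Type} [MeasurableSpace S] (step : S → Measure S) :
    Measure (Vertex d × ℕ × S → S) :=
  Measure.infinitePi fun i => step i.2.2

/-- The walk of the frog `f`, on its own clock: if it is in the state `s` after `k` steps, it then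
moves to the state `ω (f, k, s)`. Under `randomness d step` these walks are independent Markov
chains with transition law `step`, started from `start f`. -/
def walk {d : ℕ} {S : Type} (start : Vertex d → S) (ω : Vertex d × ℕ × S → S) (f : Vertex d) :
    ℕ → S
  | 0 => start f
  | k + 1 => ω (f, k, walk start ω f k)

/-! ### The frog dynamics along given paths -/

/-- The status of a frog: asleep, active (with the number of steps made since waking), or killed. -/
inductive Status where
  | asleep
  | active (k : ℕ)
  | killed

/-- The configuration of the process at one time: the status of each frog, where a frog is
labelled by the vertex on which it is placed initially. -/
abbrev Config (d : ℕ) : Type := Vertex d → Status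

/-- Frog paths: the position of each frog after `k` steps on its own clock (`none` if the frog is
no longer on the tree). -/
abbrev FrogPaths (d : ℕ) : Type := Vertex d → ℕ → Option (Vertex d)

/-- In the configuration `σ` the frog `f` is active and sits at `v`. -/
def IsAt {d : ℕ} (X : FrogPaths d) (σ : Config d) (f v : Vertex d) : Prop :=
  ∃ k, σ f = Status.active k ∧ X f k = some v

/-- In the configuration `σ` the frog `f` is active, sits at `v`, and its next step attempts to
jump to `u`. -/
def Jumps {d : ℕ} (X : FrogPaths d) (σ : Config d) (f v u : Vertex d) : Prop :=
  ∃ k, σ f = Status.active k ∧ X f k = some v ∧ X f (k + 1) = some u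

open Classical in
/-- One time step. `kill X σ f` says that the next jump of the frog `f` kills it. All active frogs
make one step along their paths, unless they are killed, and a sleeping frog wakes up if some frog
that is not killed jumps to its vertex. -/
noncomputable def nextConfig {d : ℕ} (kill : FrogPaths d → Config d → Vertex d → Prop)
    (X : FrogPaths d) (σ : Config d) : Config d := fun f =>
  match σ f with
  | Status.killed => Status.killed
  | Status.active k => if kill X σ f then Status.killed else Status.active (k + 1)
  | Status.asleep =>
      if ∃ g v, Jumps X σ g v f ∧ ¬ kill X σ g then Status.active 0 else Status.asleep

/-- The configuration at time `n`. At time `0` the frog at the root is active, all others sleep. -/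
noncomputable def config {d : ℕ} (kill : FrogPaths d → Config d → Vertex d → Prop)
    (X : FrogPaths d) : ℕ → Config d
  | 0 => fun f => match f with
      | [] => Status.active 0
      | _ :: _ => Status.asleep
  | n + 1 => nextConfig kill X (config kill X n)

/-- The total number of visits to the root (the initial position of the first frog at time `0` is
not counted; simultaneous visits of several frogs are counted separately). -/
noncomputable def rootVisits {d : ℕ} (kill : FrogPaths d → Config d → Vertex d → Prop)
    (X : FrogPaths d) : ℕ∞ :=
  Set.encard {q : Vertex d × ℕ | 1 ≤ q.2 ∧ IsAt X (config kill X q.2) q.1 []}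

/-! ### The frog model `FM(d, p)` -/

/-- One step of a frog in `FM(d, p)`: from the root to a uniformly chosen child; from any other
vertex to the parent with probability `p` and to each child with probability `(1 - p) / d`. -/
noncomputable def fmStep (d : ℕ) (p : ℝ) : Vertex d → Measure (Vertex d)
  | [] => ∑ i : Fin d, ENNReal.ofReal (1 / d) • Measure.dirac [i]
  | a :: v => ENNReal.ofReal p • Measure.dirac v
      + ∑ i : Fin d, ENNReal.ofReal ((1 - p) / d) • Measure.dirac (i :: a :: v)

/-- `FM(d, p)` is recurrent: almost surely the root is visited infinitely often. -/
def FMRecurrent (d : ℕ) (p : ℝ) : Prop :=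
  randomness d (fmStep d p)
    {ω | rootVisits (fun _ _ _ => False) (fun f k => some (walk id ω f k)) = ⊤} = 1

/-! ### Non-backtracking frogs killed at the root, and the self-similar frog model -/

/-- States of a non-backtracking frog: at `v` and just woken up; at `v` after an upward step from
the child `a :: v`; at `v` after a downward step; or killed at the root at an earlier time. -/
inductive NBState (d : ℕ) : Type where
  | fresh (v : Vertex d)
  | up (v : Vertex d) (a : Fin d)
  | down (v : Vertex d)
  | gone

instance (d : ℕ) : MeasurableSpace (NBState d) := ⊤

instance (d : ℕ) : DiscreteMeasurableSpace (NBState d) := ⟨fun _ => trivial⟩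

/-- The position of a non-backtracking frog. -/
def NBState.pos {d : ℕ} : NBState d → Option (Vertex d)
  | fresh v => some v
  | up v _ => some v
  | down v => some v
  | gone => none

/-- The probability that an upward step (not ending at the root) is followed by another one. -/
noncomputable def upAgain (d : ℕ) (p : ℝ) : ℝ := p / (p + (1 - p) * (d - 1) / d)

/-- One step of a frog in the non-backtracking frog model with drift `p`. The first step of the
frog that starts at the root goes to a uniform child. The first step of any other frog goes up with
probability `p` and otherwise to a uniform child. After an upward step the frog is killed if it is
at the root, and otherwise goes up again with probability `upAgain d p` or to one of the
`d - 1` children that it does not come from, all equally likely. After a downward step it goes to a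
uniform child. -/
noncomputable def nbStep (d : ℕ) (p : ℝ) : NBState d → Measure (NBState d)
  | .fresh [] => ∑ i : Fin d, ENNReal.ofReal (1 / d) • Measure.dirac (.down [i])
  | .fresh (a :: v) => ENNReal.ofReal p • Measure.dirac (.up v a)
      + ∑ i : Fin d, ENNReal.ofReal ((1 - p) / d) • Measure.dirac (.down (i :: a :: v))
  | .up [] _ => Measure.dirac .gone
  | .up (b :: v) a => ENNReal.ofReal (upAgain d p) • Measure.dirac (.up v b)
      + ∑ i ∈ Finset.univ.erase a,
          ENNReal.ofReal ((1 - upAgain d p) / (d - 1)) • Measure.dirac (.down (i :: b :: v))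
  | .down v => ∑ i : Fin d, ENNReal.ofReal (1 / d) • Measure.dirac (.down (i :: v))
  | .gone => Measure.dirac .gone

/-- The additional killing rule of the self-similar frog model. A frog that attempts to jump from a
vertex `v` down to its child `i :: v` is killed if that child has been visited before, i.e. if the
frog placed there is no longer asleep. If several frogs attempt to make the first visit from `v` to
`i :: v` at the same time, only one of them (the one with the smallest label in the lexicographic
order) survives. Thus each vertex is entered at most once from its parent. -/
def sfmKill {d : ℕ} (X : FrogPaths d) (σ : Config d) (f : Vertex d) : Prop :=
  ∃ (v : Vertex d) (i : Fin d), Jumps X σ f v (i :: v) ∧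
    (σ (i :: v) ≠ Status.asleep ∨ ∃ g : Vertex d, g < f ∧ Jumps X σ g v (i :: v))

/-- `SFM(d, p)` is recurrent: almost surely the root is visited infinitely often. -/
def SFMRecurrent (d : ℕ) (p : ℝ) : Prop :=
  randomness d (nbStep d p)
    {ω | rootVisits sfmKill (fun f k => (walk NBState.fresh ω f k).pos) = ⊤} = 1

/-! ### Sanity checks: the laws above are probability measures for the parameters in question -/

theorem isProbabilityMeasure_fmStep {d : ℕ} (hd : 2 ≤ d) {p : ℝ} (h0 : 0 ≤ p) (h1 : p ≤ 1)
    (v : Vertex d) : IsProbabilityMeasure (fmStep d p v) := by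
  have hd' : (2 : ℝ) ≤ d := by exact_mod_cast hd
  constructor
  rcases v with _ | ⟨a, v⟩
  · simp only [fmStep, Measure.coe_finsetSum, Finset.sum_apply, Measure.smul_apply, measure_univ,
      smul_eq_mul, mul_one]
    rw [← ENNReal.ofReal_sum_of_nonneg (fun _ _ => by positivity)]
    simp only [Finset.sum_const, Finset.card_univ, Fintype.card_fin, nsmul_eq_mul]
    rw [mul_one_div_cancel (by positivity), ENNReal.ofReal_one]
  · simp only [fmStep, Measure.add_apply, Measure.coe_finsetSum, Finset.sum_apply,
      Measure.smul_apply, measure_univ, smul_eq_mul, mul_one]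
    have h2 : 0 ≤ (1 - p) / d := div_nonneg (by linarith) (by positivity)
    rw [← ENNReal.ofReal_sum_of_nonneg (fun _ _ => h2),
      ← ENNReal.ofReal_add h0 (Finset.sum_nonneg fun _ _ => h2)]
    simp only [Finset.sum_const, Finset.card_univ, Fintype.card_fin, nsmul_eq_mul]
    rw [mul_div_cancel₀ _ (by positivity), add_sub_cancel, ENNReal.ofReal_one]

theorem upAgain_mem {d : ℕ} (hd : 2 ≤ d) {p : ℝ} (h0 : 0 ≤ p) (h1 : p ≤ 1) :
    0 ≤ upAgain d p ∧ upAgain d p ≤ 1 := by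
  have hd' : (2 : ℝ) ≤ d := by exact_mod_cast hd
  have h2 : 0 ≤ (1 - p) * (d - 1) / d :=
    div_nonneg (mul_nonneg (by linarith) (by linarith)) (by positivity)
  exact ⟨div_nonneg h0 (by linarith), div_le_one_of_le₀ (by linarith) (by linarith)⟩

theorem isProbabilityMeasure_nbStep {d : ℕ} (hd : 2 ≤ d) {p : ℝ} (h0 : 0 ≤ p) (h1 : p ≤ 1)
    (s : NBState d) : IsProbabilityMeasure (nbStep d p s) := by
  have hd' : (2 : ℝ) ≤ d := by exact_mod_cast hd
  have hu := upAgain_mem hd h0 h1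
  constructor
  rcases s with (_ | ⟨a, v⟩) | ⟨_ | ⟨b, v⟩, a⟩ | v | _
  · simp only [nbStep, Measure.coe_finsetSum, Finset.sum_apply, Measure.smul_apply, measure_univ,
      smul_eq_mul, mul_one]
    rw [← ENNReal.ofReal_sum_of_nonneg (fun _ _ => by positivity)]
    simp only [Finset.sum_const, Finset.card_univ, Fintype.card_fin, nsmul_eq_mul]
    rw [mul_one_div_cancel (by positivity), ENNReal.ofReal_one]
  · simp only [nbStep, Measure.add_apply, Measure.coe_finsetSum, Finset.sum_apply,
      Measure.smul_apply, measure_univ, smul_eq_mul, mul_one]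
    have h2 : 0 ≤ (1 - p) / d := div_nonneg (by linarith) (by positivity)
    rw [← ENNReal.ofReal_sum_of_nonneg (fun _ _ => h2),
      ← ENNReal.ofReal_add h0 (Finset.sum_nonneg fun _ _ => h2)]
    simp only [Finset.sum_const, Finset.card_univ, Fintype.card_fin, nsmul_eq_mul]
    rw [mul_div_cancel₀ _ (by positivity), add_sub_cancel, ENNReal.ofReal_one]
  · simp only [nbStep, measure_univ]
  · simp only [nbStep, Measure.add_apply, Measure.coe_finsetSum, Finset.sum_apply,
      Measure.smul_apply, measure_univ, smul_eq_mul, mul_one]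
    have h2 : 0 ≤ (1 - upAgain d p) / (d - 1) := div_nonneg (by linarith) (by linarith)
    rw [← ENNReal.ofReal_sum_of_nonneg (fun _ _ => h2),
      ← ENNReal.ofReal_add hu.1 (Finset.sum_nonneg fun _ _ => h2)]
    simp only [Finset.sum_const, Finset.card_erase_of_mem (Finset.mem_univ _), Finset.card_univ,
      Fintype.card_fin, nsmul_eq_mul]
    rw [Nat.cast_sub (by omega), Nat.cast_one, mul_div_cancel₀ _ (by linarith), add_sub_cancel,
      ENNReal.ofReal_one]
  · simp only [nbStep, Measure.coe_finsetSum, Finset.sum_apply, Measure.smul_apply, measure_univ,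
      smul_eq_mul, mul_one]
    rw [← ENNReal.ofReal_sum_of_nonneg (fun _ _ => by positivity)]
    simp only [Finset.sum_const, Finset.card_univ, Fintype.card_fin, nsmul_eq_mul]
    rw [mul_one_div_cancel (by positivity), ENNReal.ofReal_one]
  · simp only [nbStep, measure_univ]

/-- The parameter of the self-similar model in the comparison is in `[0, 1]`. -/
theorem pStar_mem {d : ℕ} (hd : 2 ≤ d) {p : ℝ} (h0 : 0 ≤ p) (h1 : p ≤ 1 / 2) :
    0 ≤ p * (d - 1) / (d - (d + 1) * p) ∧ p * (d - 1) / (d - (d + 1) * p) ≤ 1 := by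
  have hd' : (2 : ℝ) ≤ d := by exact_mod_cast hd
  have h2 : 0 < d - (d + 1) * p := by nlinarith
  refine ⟨div_nonneg (mul_nonneg h0 (by linarith)) h2.le, ?_⟩
  rw [div_le_one h2]
  nlinarith

/-! Recurrence is reduced to the ranges of the individual walks. A frog is woken once its vertex
lies in the range of a woken frog, so the set of woken frogs is increasing in the ranges, and the
ranges are independent. Forgetting the killing in the self-similar model only wakes more frogs. A
non-backtracking frog visits the root at most once, and the root's own frog never returns, so
recurrence of the self-similar model yields infinitely many distinct `returners`. In the frog model
nothing is killed, so infinitely many returners give infinitely many visits. For `p < 1/2` it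
therefore suffices that the range of one frog-model walk stochastically dominates the range of a
non-backtracking walk from the same vertex (`chainNoise_nbRange_le_fmRange`).
`pi_mono_of_isUpperSet` carries this over to all frogs in a finite ball, and
`le_encard_returners_iff` to the whole tree.

The comparison for one frog uses martingales instead of a coupling. The non-backtracking range is
contained in the geodesic from `v` to the current position, while the frog-model range contains that
geodesic. Fix an increasing family `U` that only sees levels up to `L`, and let `r = p / (1 - p)`,
the chance that the drifting walk ever reaches its parent. `nbVal` is a martingale that is at least
`1` once the range is in `U`, so Markov's inequality makes its initial value an upper bound
(`chainNoise_nbRange_le`). `walkVal` is at most `1`, is a martingale as long as the range is outside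
`U`, and dies out if this lasts forever because the walk escapes, so its initial value is a lower
bound (`walkVal_le_chainNoise`). The initial values are ordered by `nbVal_le`. The drift `p*` is the
one for which, away from the root, the non-backtracking walk has the law of the loop-erased
frog-model walk.

At `p = 1/2` one has `r = 1` and the walk does not escape. There the level of the initial frog is a
reflected simple random walk, and this frog alone returns infinitely often (`fmRecurrent_half`). -/

/-! ### A single Markov chain driven by independent random states -/

/-- The independent random states driving one chain. -/
noncomputable def chainNoise {S : Type} [MeasurableSpace S] (step : S → Measure S) :
    Measure (ℕ × S → S) :=
  Measure.infinitePi fun i => step i.2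

/-- The chain started at `s`: if it is at `x` after `k` steps, it then moves to `ω (k, x)`. -/
def traj {S : Type} (s : S) (ω : ℕ × S → S) : ℕ → S
  | 0 => s
  | k + 1 => ω (k, traj s ω k)

/-- The events determined by the random states used before time `t`. -/
abbrev chainPast (S : Type) [MeasurableSpace S] (t : ℕ) : MeasurableSpace (ℕ × S → S) :=
  ⨆ i ∈ {i : ℕ × S | i.1 < t}, MeasurableSpace.comap (fun ω : ℕ × S → S => ω i) inferInstance

section Chain

variable {S : Type} [MeasurableSpace S]

theorem chainPast_le (t : ℕ) : chainPast S t ≤ MeasurableSpace.pi :=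
  iSup₂_le fun i _ => (measurable_pi_apply i).comap_le

theorem measurable_eval_chainPast {t k : ℕ} (hk : k < t) (x : S) :
    Measurable[chainPast S t] fun ω : ℕ × S → S => ω (k, x) := by
  have h : MeasurableSpace.comap (fun ω : ℕ × S → S => ω (k, x)) inferInstance
      ≤ chainPast S t :=
    le_iSup₂_of_le (f := fun (i : ℕ × S) (_ : i ∈ {i : ℕ × S | i.1 < t}) =>
      MeasurableSpace.comap (fun ω : ℕ × S → S => ω i) inferInstance) (k, x) hk le_rfl
  exact (comap_measurable _).mono h le_rfl

theorem isProbabilityMeasure_chainNoise (step : S → Measure S)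
    [∀ x, IsProbabilityMeasure (step x)] : IsProbabilityMeasure (chainNoise step) := by
  unfold chainNoise; infer_instance

variable [Countable S] [DiscreteMeasurableSpace S]

/-- Which driving coordinate is read at a step depends on the current state; splitting over the
countably many states leaves a fixed coordinate on each piece. -/
theorem measurable_traj_chainPast (s : S) {t k : ℕ} (hk : k ≤ t) :
    Measurable[chainPast S t] fun ω : ℕ × S → S => traj s ω k := by
  induction k with
  | zero => exact @measurable_const _ _ _ (chainPast S t) _
  | succ k ih =>
    intro B _
    have : (fun ω : ℕ × S → S => traj s ω (k + 1)) ⁻¹' B =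
        ⋃ x : S, ((fun ω : ℕ × S → S => traj s ω k) ⁻¹' {x}) ∩
          ((fun ω : ℕ × S → S => ω (k, x)) ⁻¹' B) := by
      ext ω
      simp [traj]
    rw [this]
    exact @MeasurableSet.iUnion _ _ (chainPast S t) _ _ fun x =>
      @MeasurableSet.inter _ (chainPast S t) _ _ (ih (by omega) (MeasurableSet.of_discrete))
        (measurable_eval_chainPast (by omega) x MeasurableSet.of_discrete)

theorem measurable_traj (s : S) (k : ℕ) : Measurable fun ω : ℕ × S → S => traj s ω k :=
  (measurable_traj_chainPast s le_rfl).mono (chainPast_le k) le_rfl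

/-- Events that only depend on the first `t` steps of the chain belong to the past. -/
theorem measurableSet_chainPast (s : S) (t : ℕ) (B : Set (Fin (t + 1) → S)) :
    MeasurableSet[chainPast S t] {ω : ℕ × S → S | (fun k : Fin (t + 1) => traj s ω k) ∈ B} := by
  have h : @Measurable _ _ (chainPast S t) _
      fun (ω : ℕ × S → S) (k : Fin (t + 1)) => traj s ω k :=
    @measurable_pi_lambda _ _ _ (chainPast S t) _ _
      fun k => measurable_traj_chainPast s (Nat.lt_succ_iff.1 k.2)
  exact h MeasurableSet.of_discrete

/-- The Markov property for one step. -/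
theorem setLIntegral_traj_succ (step : S → Measure S) [∀ x, IsProbabilityMeasure (step x)]
    (s : S) (t : ℕ) {A : Set (ℕ × S → S)} (hA : MeasurableSet[chainPast S t] A)
    (Φ : S → ℝ≥0∞) :
    ∫⁻ ω in A, Φ (traj s ω (t + 1)) ∂chainNoise step =
      ∫⁻ ω in A, ∫⁻ z, Φ z ∂step (traj s ω t) ∂chainNoise step := by
  have := isProbabilityMeasure_chainNoise step
  -- On the piece where the chain is at `x` at time `t`, the next state is the coordinate `(t, x)`,
  -- which is independent of the past.
  set C : S → Set (ℕ × S → S) := fun x => A ∩ {ω | traj s ω t = x} with hC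
  have hCp : ∀ x, MeasurableSet[chainPast S t] (C x) := fun x =>
    @MeasurableSet.inter _ (chainPast S t) _ _ hA
      (measurable_traj_chainPast s le_rfl (MeasurableSet.of_discrete (s := {x})))
  have hCm : ∀ x, MeasurableSet (C x) := fun x => chainPast_le t _ (hCp x)
  have hAC : A = ⋃ x, C x := by ext ω; simp [hC]
  have hdisj : Pairwise (Function.onFun Disjoint C) := by
    intro x y hxy
    refine Set.disjoint_left.2 fun ω h1 h2 => hxy ?_
    rw [← h1.2, ← h2.2]
  rw [hAC, lintegral_iUnion hCm hdisj, lintegral_iUnion hCm hdisj]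
  congr 1
  ext x
  have hind : ProbabilityTheory.Indep (chainPast S t)
      (MeasurableSpace.comap (fun ω : ℕ × S → S => ω (t, x)) inferInstance)
      (chainNoise step) := by
    have h1 : ProbabilityTheory.iIndepFun (fun (i : ℕ × S) (ω : ℕ × S → S) => ω i)
        (chainNoise step) :=
      ProbabilityTheory.iIndepFun_infinitePi (P := fun i : ℕ × S => step i.2)
        (X := fun _ y => y) fun _ => measurable_id
    have h2 := ProbabilityTheory.indep_iSup_of_disjoint
      (fun i : ℕ × S => (measurable_pi_apply i).comap_le) h1
      (S := {i : ℕ × S | i.1 < t}) (T := {(t, x)}) (by simp)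
    simpa [chainPast] using h2
  calc ∫⁻ ω in C x, Φ (traj s ω (t + 1)) ∂chainNoise step
      = ∫⁻ ω in C x, Φ (ω (t, x)) ∂chainNoise step := by
        refine setLIntegral_congr_fun (hCm x) fun ω hω => ?_
        have : traj s ω t = x := hω.2
        simp [traj, this]
    _ = ∫⁻ ω, (C x).indicator 1 ω * Φ (ω (t, x)) ∂chainNoise step := by
        rw [← lintegral_indicator (hCm x)]
        congr 1
        ext ω
        by_cases h : ω ∈ C x <;> simp [h]
    _ = (∫⁻ ω, (C x).indicator 1 ω ∂chainNoise step) * ∫⁻ ω, Φ (ω (t, x)) ∂chainNoise step := by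
        refine ProbabilityTheory.lintegral_mul_eq_lintegral_mul_lintegral_of_independent_measurableSpace
          (chainPast_le t) (measurable_pi_apply (t, x)).comap_le hind ?_ ?_
        · exact Measurable.indicator (m := chainPast S t) (f := (1 : (ℕ × S → S) → ℝ≥0∞))
            (@measurable_const _ _ _ (chainPast S t) (1 : ℝ≥0∞)) (hCp x)
        · exact (Measurable.of_discrete (f := Φ)).comp (comap_measurable _)
    _ = chainNoise step (C x) * ∫⁻ z, Φ z ∂step x := by
        rw [lintegral_indicator_one (hCm x)]
        congr 1
        have h := (measurePreserving_eval_infinitePi (fun i : ℕ × S => step i.2) (t, x))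
        exact h.lintegral_comp (Measurable.of_discrete (f := Φ))
    _ = ∫⁻ ω in C x, ∫⁻ z, Φ z ∂step (traj s ω t) ∂chainNoise step := by
        rw [setLIntegral_congr_fun (hCm x) (g := fun _ => ∫⁻ z, Φ z ∂step x)]
        · rw [setLIntegral_const, mul_comm]
        · intro ω hω
          have : traj s ω t = x := hω.2
          simp [this]

end Chain

/-! ### Independence of the walks -/

theorem walk_eq_traj {d : ℕ} {S : Type} (start : Vertex d → S) (ω : Vertex d × ℕ × S → S)
    (f : Vertex d) (k : ℕ) : walk start ω f k = traj (start f) (fun i => ω (f, i)) k := by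
  induction k with
  | zero => rfl
  | succ k ih => simp [walk, traj, ih]

/-- Observations of the walks of finitely many frogs are independent. -/
theorem randomness_map_pi {d : ℕ} {S : Type} [MeasurableSpace S]
    (step : S → Measure S) [∀ x, IsProbabilityMeasure (step x)] {ι : Type} [Fintype ι]
    {e : ι → Vertex d} (he : Function.Injective e) {Y : Type} [MeasurableSpace Y]
    {G : ι → (ℕ × S → S) → Y} (hG : ∀ i, Measurable (G i)) :
    (randomness d step).map (fun ω i => G i fun j => ω (e i, j)) =
      Measure.pi fun i => (chainNoise step).map (G i) := by
  have hp : IsProbabilityMeasure (chainNoise step) := by unfold chainNoise; infer_instance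
  -- Currying turns the global family of random states into an independent family of chain noises,
  -- one per frog; restriction to finitely many frogs and observation through `G` keep the product
  -- form.
  have h1 := Measure.infinitePi_map_curry (ι := Vertex d) (κ := ℕ × S) (X := S)
    (μ := fun _ j => step j.2)
  have h2 := Measure.map_infinitePi_infinitePi_of_inj
    (P := fun _ : Vertex d => chainNoise step) he
  have h3 := Measure.infinitePi_map_pi (μ := fun _ : ι => chainNoise step) (f := G) hG
  have (i : ι) : IsProbabilityMeasure ((chainNoise step).map (G i)) :=
    Measure.isProbabilityMeasure_map (hG i).aemeasurable
  rw [← Measure.infinitePi_eq_pi, ← h3, ← h2]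
  have h1' : (randomness d step).map (MeasurableEquiv.curry (Vertex d) (ℕ × S) S) =
    Measure.infinitePi (fun _ : Vertex d => chainNoise step) := h1
  rw [← h1', Measure.map_map, Measure.map_map]
  · rfl
  · fun_prop
  · fun_prop
  · fun_prop
  · fun_prop

/-! ### Stochastic domination for product measures -/

/-- Domination on up-sets gives domination of the integrals of monotone functions. -/
theorem lintegral_mono_of_isUpperSet {Y : Type} [MeasurableSpace Y] [DiscreteMeasurableSpace Y]
    [Preorder Y] {ν ν' : Measure Y} [IsFiniteMeasure ν] [IsFiniteMeasure ν']
    (h : ∀ U : Set Y, IsUpperSet U → ν' U ≤ ν U) {φ : Y → ℝ≥0∞} (hφ : Monotone φ)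
    (hφ1 : ∀ y, φ y ≤ 1) : ∫⁻ y, φ y ∂ν' ≤ ∫⁻ y, φ y ∂ν := by
  have hr : ∀ y, φ y = ENNReal.ofReal (φ y).toReal := fun y =>
    (ENNReal.ofReal_toReal (ne_top_of_le_ne_top ENNReal.one_ne_top (hφ1 y))).symm
  simp_rw [fun m : Measure Y => lintegral_congr (μ := m) hr]
  -- Layer-cake formula: the superlevel sets of a monotone function are up-sets.
  rw [lintegral_eq_lintegral_meas_lt _ (Filter.Eventually.of_forall fun _ => ENNReal.toReal_nonneg)
      Measurable.of_discrete.aemeasurable,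
    lintegral_eq_lintegral_meas_lt _ (Filter.Eventually.of_forall fun _ => ENNReal.toReal_nonneg)
      Measurable.of_discrete.aemeasurable]
  refine lintegral_mono fun t => h _ ?_
  intro x y hxy hx
  exact lt_of_lt_of_le hx (ENNReal.toReal_mono
    (ne_top_of_le_ne_top ENNReal.one_ne_top (hφ1 y)) (hφ hxy))

/-- A product of dominating measures dominates on up-sets. -/
theorem pi_mono_of_isUpperSet {ι : Type} [Fintype ι] {Y : Type} [MeasurableSpace Y]
    [Finite Y] [DiscreteMeasurableSpace Y] [Preorder Y] {ν ν' : ι → Measure Y}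
    [∀ i, IsProbabilityMeasure (ν i)] [∀ i, IsProbabilityMeasure (ν' i)]
    (h : ∀ i, ∀ U : Set Y, IsUpperSet U → ν' i U ≤ ν i U) {E : Set (ι → Y)} (hE : IsUpperSet E) :
    Measure.pi ν' E ≤ Measure.pi ν E := by
  classical
  set f : (ι → Y) → ℝ≥0∞ := E.indicator 1 with hf
  have hfm : Measurable f := Measurable.of_discrete
  have hf1 : ∀ x, f x ≤ 1 := fun x => by
    simp only [hf]; exact Set.indicator_le_self' (fun _ _ => zero_le) x
  have hfmono : Monotone f := by
    intro x y hxy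
    by_cases hx : x ∈ E
    · simp [hf, hx, hE hxy hx]
    · simp [hf, hx]
  have hup : ∀ {x y : ι → Y}, x ≤ y → ∀ (i : ι) (a b : Y), a ≤ b →
      Function.update x i a ≤ Function.update y i b := by
    intro x y hxy i a b hab j
    by_cases hj : j = i
    · subst hj; simpa using hab
    · simpa [hj] using hxy j
  have hone : ∀ (μ : ι → Measure Y) [∀ i, IsProbabilityMeasure (μ i)] (s : Finset ι) (x : ι → Y),
      (∫⋯∫⁻_s, f ∂μ) x ≤ 1 := by
    intro μ _ s x
    rw [lmarginal]
    calc _ ≤ ∫⁻ _, 1 ∂Measure.pi fun i : s => μ i := lintegral_mono fun _ => hf1 _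
      _ = 1 := by simp
  -- The measures are exchanged one coordinate at a time. Monotonicity of the partial integral is
  -- carried along because the exchange in the next coordinate needs it.
  have key : ∀ s : Finset ι, Monotone (∫⋯∫⁻_s, f ∂ν') ∧ ∫⋯∫⁻_s, f ∂ν' ≤ ∫⋯∫⁻_s, f ∂ν := by
    intro s
    induction s using Finset.induction_on with
    | empty => simpa using hfmono
    | insert i s hi ih =>
      refine ⟨fun x y hxy => ?_, fun x => ?_⟩
      · rw [lmarginal_insert _ hfm hi, lmarginal_insert _ hfm hi]
        exact lintegral_mono fun a => ih.1 (hup hxy i a a le_rfl)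
      · rw [lmarginal_insert _ hfm hi, lmarginal_insert _ hfm hi]
        refine (lintegral_mono_of_isUpperSet (h i) (fun a b hab => ih.1 (hup le_rfl i a b hab))
          fun a => hone ν' s _).trans (lintegral_mono fun a => ih.2 _)
  rcases isEmpty_or_nonempty (ι → Y) with hemp | ⟨⟨x⟩⟩
  · simp [Set.eq_empty_of_isEmpty E]
  · have := (key Finset.univ).2 x
    rw [lmarginal_univ, lmarginal_univ] at this
    simpa [hf, lintegral_indicator_one (MeasurableSet.of_discrete (s := E))] using this

/-! ### Frogs woken up through ranges of walks -/

/-- The frogs woken up when frog `f` visits the set `R f` and only frogs in `F` are taken into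
account. -/
inductive Reach {d : ℕ} (R : Vertex d → Set (Vertex d)) (F : Set (Vertex d)) : Vertex d → Prop
  | root : Reach R F []
  | step {f g : Vertex d} : Reach R F f → g ∈ R f → g ∈ F → Reach R F g

theorem Reach.mono {d : ℕ} {R R' : Vertex d → Set (Vertex d)} {F F' : Set (Vertex d)}
    (hR : ∀ f ∈ F, ∀ u ∈ F, u ∈ R f → u ∈ R' f) (hF : F ⊆ F') (h0 : [] ∈ F) {f : Vertex d}
    (h : Reach R F f) : Reach R' F' f := by
  have key : f ∈ F ∧ Reach R' F' f := by
    induction h with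
    | root => exact ⟨h0, .root⟩
    | step _ hg hgF ih => exact ⟨hgF, ih.2.step (hR _ ih.1 _ hgF hg) (hF hgF)⟩
  exact key.2

/-- The frogs, other than the one at the root, that are woken up and visit the root. -/
def returners {d : ℕ} (R : Vertex d → Set (Vertex d)) (F : Set (Vertex d)) : Set (Vertex d) :=
  {f | f ≠ [] ∧ Reach R F f ∧ [] ∈ R f}

/-- The vertices up to a given level. -/
def treeBall (d n : ℕ) : Set (Vertex d) := {v | v.length ≤ n}

instance (d n : ℕ) : Finite (treeBall d n) := List.finite_length_le (Fin d) n

/-- The ranges encoded by a relation on a ball. -/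
def rangeOfRel {d n : ℕ} (Z : treeBall d n → treeBall d n → Prop) (f : Vertex d) :
    Set (Vertex d) :=
  {u | ∃ (hf : f ∈ treeBall d n) (hu : u ∈ treeBall d n), Z ⟨f, hf⟩ ⟨u, hu⟩}

/-- The relations on a ball for which at least `m` frogs return to the root. -/
def manyReturns (d n m : ℕ) : Set (treeBall d n → treeBall d n → Prop) :=
  {Z | (m : ℕ∞) ≤ (returners (rangeOfRel Z) (treeBall d n)).encard}

theorem isUpperSet_manyReturns (d n m : ℕ) : IsUpperSet (manyReturns d n m) := by
  intro Z Z' hZ h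
  refine le_trans h (Set.encard_le_encard fun f hf => ?_)
  have hmono : ∀ f u, u ∈ rangeOfRel Z f → u ∈ rangeOfRel Z' f :=
    fun f u ⟨h1, h2, h3⟩ => ⟨h1, h2, hZ _ _ h3⟩
  exact ⟨hf.1, hf.2.1.mono (fun f _ u _ => hmono f u) subset_rfl (by simp [treeBall]),
    hmono _ _ hf.2.2⟩

/-- A frog is woken through a finite chain of frogs, which fits into a ball. -/
theorem Reach.exists_treeBall {d : ℕ} {R : Vertex d → Set (Vertex d)} {f : Vertex d}
    (h : Reach R Set.univ f) : ∃ n, f ∈ treeBall d n ∧ Reach R (treeBall d n) f := by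
  induction h with
  | root => exact ⟨0, by simp [treeBall], .root⟩
  | @step f g _ hg _ ih =>
    obtain ⟨n, hn, ih⟩ := ih
    have hsub : treeBall d n ⊆ treeBall d (max n g.length) :=
      fun v (hv : v.length ≤ n) =>
        show v.length ≤ max n g.length from le_trans hv (le_max_left _ _)
    have hgm : g ∈ treeBall d (max n g.length) :=
      show g.length ≤ max n g.length from le_max_right _ _
    exact ⟨_, hgm, (ih.mono (fun _ _ _ _ h => h) hsub (by simp [treeBall])).step hg hgm⟩

/-- Having `m` returners is witnessed by finitely many finite waking chains. This reduces the event
to increasing events on finite balls, where product measures can be compared. -/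
theorem le_encard_returners_iff {d : ℕ} (R : Vertex d → Set (Vertex d)) (m : ℕ) :
    (m : ℕ∞) ≤ (returners R Set.univ).encard ↔
      ∃ n, (fun f u : treeBall d n => (u : Vertex d) ∈ R f) ∈ manyReturns d n m := by
  constructor
  · intro h
    obtain ⟨T, hT, hTm⟩ := Set.exists_subset_encard_eq h
    have hfin : T.Finite := Set.finite_of_encard_eq_coe hTm
    choose N hN using fun f : T => (hT f.2).2.1.exists_treeBall
    have := hfin.to_subtype
    obtain ⟨n, hn⟩ := (Set.finite_range N).bddAbove
    refine ⟨n, ?_⟩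
    change (m : ℕ∞) ≤ Set.encard _
    rw [← hTm]
    refine Set.encard_le_encard fun f hf => ?_
    have hsub : treeBall d (N ⟨f, hf⟩) ⊆ treeBall d n :=
      fun v (hv : v.length ≤ N ⟨f, hf⟩) => show v.length ≤ n from le_trans hv (hn ⟨_, rfl⟩)
    have h0 : ([] : Vertex d) ∈ treeBall d n := by simp [treeBall]
    have hfN := hN ⟨f, hf⟩
    refine ⟨(hT hf).1, ?_, hsub hfN.1, h0, (hT hf).2.2⟩
    exact hfN.2.mono (fun f hf u hu h =>
      show u ∈ rangeOfRel _ f from ⟨hsub hf, hsub hu, h⟩) hsub (by simp [treeBall])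
  · rintro ⟨n, hn⟩
    refine le_trans hn (Set.encard_le_encard fun f hf => ?_)
    have hmono : ∀ f u, u ∈ rangeOfRel (fun f u : treeBall d n => (u : Vertex d) ∈ R f) f →
        u ∈ R f := fun f u ⟨_, _, h3⟩ => h3
    exact ⟨hf.1, hf.2.1.mono (fun f _ u _ => hmono f u) (Set.subset_univ _) (by simp [treeBall]),
      hmono _ _ hf.2.2⟩

/-! ### The dynamics and the ranges -/

/-- Valid for every killing rule: `Reach` uses the full paths, including what lies beyond the
killing time, so killing can only lose frogs. -/
theorem reach_of_config_ne_asleep {d : ℕ} {kill : FrogPaths d → Config d → Vertex d → Prop}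
    {X : FrogPaths d} {n : ℕ} {f : Vertex d} (h : config kill X n f ≠ Status.asleep) :
    Reach (fun f => {u | ∃ k, X f k = some u}) Set.univ f := by
  induction n generalizing f with
  | zero =>
    cases f with
    | nil => exact .root
    | cons a v => exact absurd rfl h
  | succ n ih =>
    by_cases hf : config kill X n f = Status.asleep
    · have h' : nextConfig kill X (config kill X n) f ≠ Status.asleep := h
      rw [nextConfig, hf] at h'
      simp only at h'
      split_ifs at h' with hw
      · obtain ⟨g, v, ⟨k, hk, -, hX⟩, -⟩ := hw
        exact (ih (f := g) (by rw [hk]; simp)).step ⟨k + 1, hX⟩ trivial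
      · exact absurd rfl h'
    · exact ih hf

theorem config_add {d : ℕ} {kill : FrogPaths d → Config d → Vertex d → Prop}
    {X : FrogPaths d} {n k : ℕ} {f : Vertex d} (h : config kill X n f = Status.active k) (j : ℕ) :
    config kill X (n + j) f = Status.killed ∨ config kill X (n + j) f = Status.active (k + j) := by
  induction j with
  | zero => exact Or.inr h
  | succ j ih =>
    have e : config kill X (n + (j + 1)) f = nextConfig kill X (config kill X (n + j)) f := rfl
    rw [e, nextConfig]
    rcases ih with ih | ih <;> rw [ih]
    · exact Or.inl rfl
    · simp only
      split_ifs
      · exact Or.inl rfl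
      · exact Or.inr rfl

theorem config_active_inj {d : ℕ} {kill : FrogPaths d → Config d → Vertex d → Prop}
    {X : FrogPaths d} {m n k : ℕ} {f : Vertex d} (hm : config kill X m f = Status.active k)
    (hn : config kill X n f = Status.active k) : m = n := by
  wlog hmn : m ≤ n generalizing m n
  · exact (this hn hm (by omega)).symm
  obtain ⟨j, rfl⟩ := Nat.exists_eq_add_of_le hmn
  rcases config_add hm j with h | h <;> rw [hn] at h <;> simp at h
  omega

theorem config_nil {d : ℕ} {kill : FrogPaths d → Config d → Vertex d → Prop}
    {X : FrogPaths d} {n k : ℕ} (h : config kill X n [] = Status.active k) : k = n := by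
  have h0 : config kill X 0 [] = Status.active 0 := rfl
  rcases config_add h0 n with h' | h' <;> rw [Nat.zero_add, h] at h' <;> simp at h'
  exact h'

/-- If each frog other than the one at the root visits the root at most once, and the latter frog
never returns, then infinitely many visits to the root are due to infinitely many frogs. -/
theorem encard_returners_eq_top {d : ℕ} {kill : FrogPaths d → Config d → Vertex d → Prop}
    {X : FrogPaths d} (h0 : ∀ k, X [] (k + 1) ≠ some [])
    (h1 : ∀ f k l, X f k = some [] → X f l = some [] → k = l) (h : rootVisits kill X = ⊤) :
    (returners (fun f => {u | ∃ k, X f k = some u}) Set.univ).encard = ⊤ := by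
  rw [rootVisits, Set.encard_eq_top_iff] at h
  rw [Set.encard_eq_top_iff]
  refine (h.image (f := Prod.fst) ?_).mono ?_
  · rintro ⟨f, m⟩ ⟨-, k, hk, hX⟩ ⟨g, n⟩ ⟨-, l, hl, hY⟩ (rfl : f = g)
    obtain rfl := h1 _ _ _ hX hY
    have hmn : m = n := config_active_inj hk hl
    rw [hmn]
  · rintro _ ⟨⟨f, n⟩, ⟨hn, k, hk, hX⟩, rfl⟩
    refine ⟨?_, reach_of_config_ne_asleep (by rw [hk]; simp), k, hX⟩
    rintro (rfl : f = [])
    obtain rfl := config_nil hk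
    obtain ⟨j, rfl⟩ := Nat.exists_eq_add_of_le' hn
    exact h0 j hX

theorem config_add_of_no_kill {d : ℕ} {X : FrogPaths d} {n : ℕ} {f : Vertex d}
    (h : config (fun _ _ _ => False) X n f = Status.active 0) (j : ℕ) :
    config (fun _ _ _ => False) X (n + j) f = Status.active j := by
  induction j with
  | zero => exact h
  | succ j ih =>
    have e : config (fun _ _ _ => False) X (n + (j + 1)) f =
      nextConfig (fun _ _ _ => False) X (config (fun _ _ _ => False) X (n + j)) f := rfl
    rw [e, nextConfig, ih]
    simp

theorem exists_config_eq_active_zero {d : ℕ} {X : FrogPaths d} {n : ℕ} {f : Vertex d}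
    (h : config (fun _ _ _ => False) X n f ≠ Status.asleep) :
    ∃ m, config (fun _ _ _ => False) X m f = Status.active 0 := by
  induction n with
  | zero =>
    cases f with
    | nil => exact ⟨0, rfl⟩
    | cons a v => exact absurd rfl h
  | succ n ih =>
    by_cases hf : config (fun _ _ _ => False) X n f = Status.asleep
    · refine ⟨n + 1, ?_⟩
      have e : config (fun _ _ _ => False) X (n + 1) f =
        nextConfig (fun _ _ _ => False) X (config (fun _ _ _ => False) X n) f := rfl
      rw [e, nextConfig, hf] at h ⊢
      simp only at h ⊢
      split_ifs at h ⊢ with hw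
      · rfl
      · exact absurd rfl h
    · exact ih hf

/-- Converse of `reach_of_config_ne_asleep` without killing: a woken frog follows its whole path and
hence wakes every vertex in its range. -/
theorem Reach.exists_config {d : ℕ} {Y : Vertex d → ℕ → Vertex d} (hY : ∀ f, Y f 0 = f)
    {f : Vertex d} (h : Reach (fun f => {u | ∃ k, Y f k = u}) Set.univ f) :
    ∃ n, config (fun _ _ _ => False) (fun f k => some (Y f k)) n f = Status.active 0 := by
  induction h with
  | root => exact ⟨0, rfl⟩
  | @step f g _ hg _ ih =>
    obtain ⟨n, hn⟩ := ih
    obtain ⟨k, rfl⟩ := hg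
    cases k with
    | zero => rw [hY]; exact ⟨n, hn⟩
    | succ k =>
      set X : FrogPaths d := fun f k => some (Y f k)
      refine exists_config_eq_active_zero (n := n + k + 1) ?_
      have e : config (fun _ _ _ => False) X (n + k + 1) (Y f (k + 1)) =
        nextConfig (fun _ _ _ => False) X (config (fun _ _ _ => False) X (n + k))
          (Y f (k + 1)) := rfl
      rw [e, nextConfig]
      have hw : ∃ g v, Jumps X (config (fun _ _ _ => False) X (n + k)) g v (Y f (k + 1)) ∧
          ¬ False := ⟨f, Y f k, ⟨k, config_add_of_no_kill hn k, rfl, rfl⟩, not_false⟩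
      split
      · simp
      · simp
      · rw [if_pos hw]; simp

/-- Without killing, infinitely many frogs that are woken up and visit the root produce infinitely
many visits. -/
theorem rootVisits_eq_top {d : ℕ} {Y : Vertex d → ℕ → Vertex d} (hY : ∀ f, Y f 0 = f)
    (h : (returners (fun f => {u | ∃ k, Y f k = u}) Set.univ).encard = ⊤) :
    rootVisits (fun _ _ _ => False) (fun f k => some (Y f k)) = ⊤ := by
  rw [Set.encard_eq_top_iff] at h
  rw [rootVisits, Set.encard_eq_top_iff]
  refine Set.Infinite.of_image Prod.fst (h.mono ?_)
  rintro f ⟨hf, hr, k, hk⟩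
  obtain ⟨n, hn⟩ := hr.exists_config hY
  have hk0 : k ≠ 0 := by
    rintro rfl
    exact hf ((hY f).symm.trans hk)
  exact ⟨(f, n + k), ⟨by change 1 ≤ n + k; omega, k, config_add_of_no_kill hn k, by simp [hk]⟩, rfl⟩

/-- If the frog of the root returns infinitely often, then the root is visited infinitely often. -/
theorem rootVisits_eq_top_of_root {d : ℕ} {Y : Vertex d → ℕ → Vertex d}
    (h : ∀ T, ∃ k, T ≤ k ∧ Y [] k = []) :
    rootVisits (fun _ _ _ => False) (fun f k => some (Y f k)) = ⊤ := by
  rw [rootVisits, Set.encard_eq_top_iff]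
  have hinf : {k : ℕ | 1 ≤ k ∧ Y [] k = []}.Infinite := by
    refine Set.infinite_of_not_bddAbove fun ⟨b, hb⟩ => ?_
    obtain ⟨k, hk, hk'⟩ := h (b + 1)
    have := hb (show k ∈ _ from ⟨by omega, hk'⟩)
    omega
  refine Set.Infinite.of_image Prod.snd (hinf.mono ?_)
  rintro k ⟨hk, hk'⟩
  refine ⟨([], k), ⟨hk, k, ?_, by simp [hk']⟩, rfl⟩
  have := config_add_of_no_kill (X := fun f k => some (Y f k)) (n := 0) (f := []) rfl k
  simpa using this

/-! ### Geodesics in the tree -/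

/-- The vertices on the geodesic between `v` and `w`. -/
def treePath {d : ℕ} (v w : Vertex d) : Set (Vertex d) :=
  {u | (u <:+ v ∨ u <:+ w) ∧ ∀ z, z <:+ v → z <:+ w → z <:+ u}

section TreePath

variable {d : ℕ} {v w u : Vertex d} {a i : Fin d}

theorem treePath_self (v : Vertex d) : treePath v v = {v} := by
  ext u
  constructor
  · rintro ⟨h1, h2⟩
    have h3 : u <:+ v := h1.elim id id
    exact h3.eq_of_length_le (h2 v List.suffix_rfl List.suffix_rfl).length_le
  · rintro rfl
    exact ⟨Or.inl List.suffix_rfl, fun _ h _ => h⟩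

theorem treePath_child_subset (v w : Vertex d) (i : Fin d) :
    treePath v (i :: w) ⊆ insert (i :: w) (treePath v w) := by
  rintro u ⟨h1, h2⟩
  by_cases hu : u = i :: w
  · exact Or.inl hu
  · refine Or.inr ⟨h1.imp_right fun h => ?_, fun z hz hzw => h2 z hz (hzw.trans (List.suffix_cons i w))⟩
    exact (List.suffix_cons_iff.1 h).resolve_left hu

theorem treePath_parent_subset (v w : Vertex d) (a : Fin d) :
    treePath v w ⊆ insert w (treePath v (a :: w)) := by
  rintro u ⟨h1, h2⟩
  by_cases hu : u = w
  · exact Or.inl hu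
  refine Or.inr ⟨h1.imp_right fun h => h.trans (List.suffix_cons a w), fun z hz hzw => ?_⟩
  -- If `a :: w` is an ancestor of `v`, every vertex other than `w` on the geodesic from `v` to `w`
  -- lies strictly below `w` on the branch towards `v`, hence at or below `a :: w`.
  rcases List.suffix_cons_iff.1 hzw with rfl | hzw
  · have hwu : w <:+ u := h2 w ((List.suffix_cons a w).trans hz) List.suffix_rfl
    have hlt : w.length < u.length := by
      rcases hwu.length_le.lt_or_eq with h | h
      · exact h
      · exact absurd (hwu.eq_of_length_le h.ge).symm hu
    have huv : u <:+ v := h1.resolve_right fun h => absurd h.length_le (by omega)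
    exact List.suffix_of_suffix_length_le hz huv (by simpa using hlt)
  · exact h2 z hz hzw

/-- The hypothesis says that the step down leads away from `v`, so the geodesic is only extended. -/
theorem treePath_subset_child (h : ¬ i :: w <:+ v) : treePath v w ⊆ treePath v (i :: w) := by
  rintro u ⟨h1, h2⟩
  refine ⟨h1.imp_right fun h => h.trans (List.suffix_cons i w), fun z hz hzw => ?_⟩
  rcases List.suffix_cons_iff.1 hzw with rfl | hzw
  · exact absurd hz h
  · exact h2 z hz hzw

theorem mem_treePath_right (v w : Vertex d) : w ∈ treePath v w :=
  ⟨Or.inr List.suffix_rfl, fun _ _ h => h⟩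

theorem treePath_child (h : ¬ i :: w <:+ v) :
    treePath v (i :: w) = insert (i :: w) (treePath v w) :=
  (treePath_child_subset v w i).antisymm
    (Set.insert_subset (mem_treePath_right _ _) (treePath_subset_child h))

theorem treePath_subset_parent (h : a :: w <:+ v) : treePath v (a :: w) ⊆ treePath v w := by
  rintro u ⟨h1, h2⟩
  refine ⟨h1.elim Or.inl fun h3 => Or.inl (h3.trans h), fun z hz hzw =>
    h2 z hz (hzw.trans (List.suffix_cons a w))⟩

theorem child_not_suffix (h : a :: w <:+ v) (hi : i ≠ a) : ¬ i :: w <:+ v := by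
  intro h'
  have := List.suffix_of_suffix_length_le h' h (by simp)
  have := this.eq_of_length_le (by simp)
  simp at this
  exact hi this

end TreePath

/-! ### Averages over the ends of the walks

We fix an increasing family `U` of sets of vertices that only depends on the vertices up to level
`L`, and a vertex `v` where the walks start. -/

/-- The family `U` only depends on the vertices up to level `L`. -/
def IsLocalFamily {d : ℕ} (U : Set (Set (Vertex d))) (L : ℕ) : Prop :=
  ∀ A B : Set (Vertex d), (∀ u, u.length ≤ L → (u ∈ A ↔ u ∈ B)) → (A ∈ U ↔ B ∈ U)

open Classical in
/-- The indicator that the geodesic from `v` to `w` is in `U`. -/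
noncomputable def pathVal {d : ℕ} (U : Set (Set (Vertex d))) (v w : Vertex d) : ℝ :=
  if treePath v w ∈ U then 1 else 0

/-- The mean of `pathVal` after `n` downward steps from `w` to uniform children. -/
noncomputable def descentVal {d : ℕ} (U : Set (Set (Vertex d))) (v : Vertex d) :
    ℕ → Vertex d → ℝ
  | 0, w => pathVal U v w
  | n + 1, w => (∑ i, descentVal U v n (i :: w)) / d

/-- The mean of `pathVal` at the end of a ray of uniform downward steps from `w`. -/
noncomputable def downVal {d : ℕ} (U : Set (Set (Vertex d))) (v : Vertex d) (L : ℕ)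
    (w : Vertex d) : ℝ :=
  descentVal U v (L - w.length) w

/-- The mean of `downVal` at the highest ancestor reached by a walk from `w`, where `r` is the
probability to reach the parent. -/
noncomputable def walkVal {d : ℕ} (U : Set (Set (Vertex d))) (v : Vertex d) (L : ℕ) (r : ℝ) :
    Vertex d → ℝ
  | [] => max (pathVal U v []) (downVal U v L [])
  | a :: w => r * walkVal U v L r w + (1 - r) * downVal U v L (a :: w)

/-- The value for a non-backtracking walk at `w` after an upward step from `a :: w`. -/
noncomputable def upVal {d : ℕ} (U : Set (Set (Vertex d))) (v : Vertex d) (L : ℕ) (r : ℝ) :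
    Vertex d → Fin d → ℝ
  | [], _ => pathVal U v []
  | b :: w, a => r * upVal U v L r w b +
      (1 - r) * ((∑ i ∈ Finset.univ.erase a, downVal U v L (i :: b :: w)) / (d - 1))

section Values

variable {d : ℕ} {U : Set (Set (Vertex d))} {v : Vertex d} {L : ℕ} {r : ℝ}

theorem pathVal_nonneg (w : Vertex d) : 0 ≤ pathVal U v w := by
  unfold pathVal; split_ifs <;> norm_num

theorem pathVal_le_one (w : Vertex d) : pathVal U v w ≤ 1 := by
  unfold pathVal; split_ifs <;> norm_num

theorem pathVal_mono (hU : IsUpperSet U) {v w w' : Vertex d}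
    (h : treePath v w ⊆ treePath v w') : pathVal U v w ≤ pathVal U v w' := by
  unfold pathVal
  split_ifs with h1 h2
  · exact le_rfl
  · exact absurd (hU h h1) h2
  · exact zero_le_one
  · exact le_rfl

theorem pathVal_child (hU : IsLocalFamily U L) (hv : v.length ≤ L) {w : Vertex d}
    (hw : L ≤ w.length) (i : Fin d) : pathVal U v (i :: w) = pathVal U v w := by
  have h : ¬ i :: w <:+ v := fun h => by
    have := h.length_le
    simp at this
    omega
  have : treePath v (i :: w) ∈ U ↔ treePath v w ∈ U := by
    refine hU _ _ fun u hu => ?_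
    rw [treePath_child h, Set.mem_insert_iff, or_iff_right]
    rintro rfl
    simp at hu
    omega
  unfold pathVal
  split_ifs <;> tauto

theorem descentVal_mem (hd : 2 ≤ d) (n : ℕ) (w : Vertex d) :
    0 ≤ descentVal U v n w ∧ descentVal U v n w ≤ 1 := by
  have hd' : (0 : ℝ) < d := by positivity
  induction n generalizing w with
  | zero => exact ⟨pathVal_nonneg w, pathVal_le_one w⟩
  | succ n ih =>
    refine ⟨div_nonneg (Finset.sum_nonneg fun i _ => (ih _).1) hd'.le, ?_⟩
    rw [descentVal, div_le_one hd']
    calc _ ≤ ∑ _i : Fin d, (1 : ℝ) := Finset.sum_le_sum fun i _ => (ih _).2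
      _ = d := by simp

theorem downVal_mem (hd : 2 ≤ d) (w : Vertex d) :
    0 ≤ downVal U v L w ∧ downVal U v L w ≤ 1 := descentVal_mem hd _ _

theorem downVal_of_le {w : Vertex d} (h : L ≤ w.length) : downVal U v L w = pathVal U v w := by
  rw [downVal, Nat.sub_eq_zero_of_le h, descentVal]

theorem downVal_eq (hd : 2 ≤ d) (hU : IsLocalFamily U L) (hv : v.length ≤ L) (w : Vertex d) :
    downVal U v L w = (∑ i, downVal U v L (i :: w)) / d := by
  rcases lt_or_ge w.length L with h | h
  · obtain ⟨n, hn⟩ : ∃ n, L - w.length = n + 1 := ⟨L - w.length - 1, by omega⟩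
    have hn' : ∀ i : Fin d, L - (i :: w).length = n := fun i => by simp; omega
    simp only [downVal, hn, hn', descentVal]
  · have hd' : (d : ℝ) ≠ 0 := by positivity
    have h2 : ∀ i : Fin d, downVal U v L (i :: w) = pathVal U v w := fun i => by
      rw [downVal_of_le (by simp; omega), pathVal_child hU hv h]
    simp [h2, downVal_of_le h, hd']

/-- If no child of `w` leads towards `v`, every descent from `w` only lengthens the geodesic, and
`U` is increasing. -/
theorem pathVal_le_descentVal (hd : 2 ≤ d) (hU : IsUpperSet U) (n : ℕ) (w : Vertex d)
    (hw : ∀ i, ¬ i :: w <:+ v) : pathVal U v w ≤ descentVal U v n w := by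
  have hd' : (0 : ℝ) < d := by positivity
  induction n generalizing w with
  | zero => exact le_rfl
  | succ n ih =>
    rw [descentVal, le_div_iff₀ hd']
    calc pathVal U v w * d = ∑ _i : Fin d, pathVal U v w := by simp [mul_comm]
      _ ≤ _ := Finset.sum_le_sum fun i _ =>
        (pathVal_mono hU (treePath_subset_child (hw i))).trans
          (ih _ fun j hj => hw i ((List.suffix_cons j _).trans hj))

theorem pathVal_le_downVal (hd : 2 ≤ d) (hU : IsUpperSet U) {w : Vertex d}
    (hw : ∀ i, ¬ i :: w <:+ v) : pathVal U v w ≤ downVal U v L w :=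
  pathVal_le_descentVal hd hU _ w hw

theorem walkVal_mem (hd : 2 ≤ d) (hr : 0 ≤ r) (hr1 : r ≤ 1) (w : Vertex d) :
    0 ≤ walkVal U v L r w ∧ walkVal U v L r w ≤ 1 := by
  induction w with
  | nil => exact ⟨le_max_of_le_left (pathVal_nonneg _),
      max_le (pathVal_le_one _) (downVal_mem hd _).2⟩
  | cons a w ih =>
    have h := downVal_mem (U := U) (v := v) (L := L) hd (a :: w)
    rw [walkVal]
    constructor
    · have := mul_nonneg hr ih.1
      have := mul_nonneg (sub_nonneg.2 hr1) h.1
      linarith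
    · nlinarith [mul_le_mul_of_nonneg_left ih.2 hr,
        mul_le_mul_of_nonneg_left h.2 (sub_nonneg.2 hr1)]

theorem sum_walkVal (hd : 2 ≤ d) (hU : IsLocalFamily U L) (hv : v.length ≤ L) (w : Vertex d) :
    ∑ i, walkVal U v L r (i :: w) = d * (r * walkVal U v L r w + (1 - r) * downVal U v L w) := by
  have hd' : (d : ℝ) ≠ 0 := by positivity
  simp only [walkVal]
  rw [Finset.sum_add_distrib, ← Finset.mul_sum, ← Finset.mul_sum, downVal_eq hd hU hv w]
  simp
  field_simp

/-- The value is harmonic off the root. -/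
theorem walkVal_cons (hd : 2 ≤ d) (hU : IsLocalFamily U L) (hv : v.length ≤ L) {p : ℝ}
    (hp : r * (1 - p) = p) (a : Fin d) (w : Vertex d) :
    walkVal U v L r (a :: w) = p * walkVal U v L r w +
      ∑ i, (1 - p) / d * walkVal U v L r (i :: a :: w) := by
  have hd' : (d : ℝ) ≠ 0 := by positivity
  rw [← Finset.mul_sum, sum_walkVal hd hU hv]
  have e : (1 - p) / d * (d * (r * walkVal U v L r (a :: w) + (1 - r) * downVal U v L (a :: w)))
      = (1 - p) * (r * walkVal U v L r (a :: w) + (1 - r) * downVal U v L (a :: w)) := by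
    field_simp
  rw [e, walkVal]
  linear_combination (1 - r) * (walkVal U v L r w - downVal U v L (a :: w)) * hp

/-- The value is subharmonic at the root unless the geodesic to the root is in `U`. -/
theorem walkVal_nil (hd : 2 ≤ d) (hU : IsLocalFamily U L) (hv : v.length ≤ L)
    (h : treePath v [] ∉ U) :
    walkVal U v L r [] = ∑ i : Fin d, 1 / d * walkVal U v L r [i] := by
  have hd' : (d : ℝ) ≠ 0 := by positivity
  have h0 : walkVal U v L r [] = downVal U v L [] := by
    rw [walkVal, max_eq_right]
    simpa [pathVal, h] using (downVal_mem (U := U) (v := v) (L := L) hd []).1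
  rw [← Finset.mul_sum, sum_walkVal hd hU hv, h0]
  field_simp
  ring

/-- Below level `L` the family `U` cannot see the end of the geodesic. If the indicator vanishes
there, it still vanishes after climbing one level, and so does the descent value. Only a climb back
to level `L` can help, and each level costs a factor `r`. -/
theorem walkVal_le_pow (hd : 2 ≤ d) (hU : IsLocalFamily U L) (hv : v.length ≤ L)
    (hr : 0 ≤ r) (hr1 : r ≤ 1) {w : Vertex d} (h : pathVal U v w = 0) :
    walkVal U v L r w ≤ r ^ (w.length - L) := by
  induction w with
  | nil => simpa using (walkVal_mem hd hr hr1 []).2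
  | cons a w ih =>
    rcases lt_or_ge w.length L with hw | hw
    · rw [Nat.sub_eq_zero_of_le (by simp; omega), pow_zero]
      exact (walkVal_mem hd hr hr1 _).2
    · rw [walkVal, downVal_of_le (by simp; omega), h]
      rw [pathVal_child hU hv hw] at h
      have : (a :: w).length - L = (w.length - L) + 1 := by simp; omega
      rw [this, pow_succ]
      nlinarith [ih h]

/-- Comparison of the values: the walk has a larger value than the non-backtracking walk. -/
theorem upVal_le (hd : 2 ≤ d) (hU : IsLocalFamily U L) (hv : v.length ≤ L) (hr : 0 ≤ r)
    {α β : ℝ} (hβ : β * d = 1 - α) (hα : α = r * (1 - β)) (hα0 : 0 ≤ α) (hβ0 : 0 ≤ β)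
    (w : Vertex d) (a : Fin d) :
    (1 - β) * upVal U v L r w a + β * downVal U v L (a :: w) ≤ walkVal U v L r w := by
  have hd' : (2 : ℝ) ≤ d := by exact_mod_cast hd
  -- Away from the root, `β` is the probability that the walk from `w` ends below a given child, and
  -- `α` that it ends outside the subtree of `w`. Thus `d β + α = 1`, and `α = r (1 - β)`, since
  -- ending outside means climbing to the parent and then not ending below the child just left.
  induction w generalizing a with
  | nil =>
    have hD := downVal_mem (U := U) (v := v) (L := L) hd [a]
    rw [upVal, walkVal]
    -- The only source of strict inequality: at the root the non-backtracking frog stops, while the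
    -- walk goes on to a uniform ray.
    by_cases h : treePath v [] ∈ U
    · refine le_max_of_le_left ?_
      simp only [pathVal, h, if_true]
      nlinarith
    · refine le_max_of_le_right ?_
      simp only [pathVal, h, if_false, mul_zero, zero_add]
      rw [downVal_eq hd hU hv [], le_div_iff₀ (by positivity)]
      have h1 : downVal U v L [a] ≤ ∑ i, downVal U v L [i] :=
        Finset.single_le_sum (f := fun i => downVal U v L [i])
          (fun i _ => (downVal_mem hd _).1) (Finset.mem_univ a)
      nlinarith
  | cons b w ih =>
    have h1 := ih b
    have hs : ∑ i, downVal U v L (i :: b :: w) = downVal U v L (a :: b :: w) +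
        ∑ i ∈ Finset.univ.erase a, downVal U v L (i :: b :: w) :=
      (Finset.add_sum_erase _ _ (Finset.mem_univ a)).symm
    have h2 := downVal_eq hd hU hv (b :: w)
    rw [hs, eq_div_iff (by positivity)] at h2
    rw [upVal, walkVal]
    set E := ∑ i ∈ Finset.univ.erase a, downVal U v L (i :: b :: w)
    -- Both sides are the weight of the ends below the `d - 1` children of `b :: w` other than `a`.
    have h3 : (1 - β) * (1 - r) = β * (d - 1) := by linear_combination hα - hβ
    have h4 : (1 - β) * ((1 - r) * (E / (d - 1))) = β * E := by
      rw [← mul_assoc, h3]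
      field_simp [show (d : ℝ) - 1 ≠ 0 by linarith]
    have h5 : β * d = 1 - r + r * β := by linear_combination hβ - hα
    have h6 : β * d * downVal U v L (b :: w) = β * (downVal U v L (a :: b :: w) + E) := by
      rw [← h2]; ring
    rw [h5] at h6
    have h7 := mul_le_mul_of_nonneg_left h1 hr
    linear_combination h7 + h4 - h6

/-- The value of the non-backtracking walk at its start. -/
theorem nbVal_le (hd : 2 ≤ d) (hU : IsLocalFamily U L) (hr : 0 ≤ r)
    {α β : ℝ} (hβ : β * d = 1 - α) (hα : α = r * (1 - β)) (hα0 : 0 ≤ α) (hβ0 : 0 ≤ β)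
    {w : Vertex d} {a : Fin d} (hv : v.length ≤ L) :
    α * upVal U v L r w a + (1 - α) * downVal U v L (a :: w) ≤ walkVal U v L r (a :: w) := by
  -- After scaling by `r`, the weight of `upVal` is `r (1 - β) = α`, and that of `downVal` is `r β +
  -- (1 - r) = 1 - α`.
  have h := mul_le_mul_of_nonneg_left
    (upVal_le (L := L) (r := r) hd hU hv hr hβ hα hα0 hβ0 w a) hr
  rw [walkVal, hα]
  nlinarith

/-- From an ancestor of `v`, going up or turning to a child off the branch of `v` both extend the
geodesic, so no later indicator is smaller than the present one. -/
theorem pathVal_le_upVal (hd : 2 ≤ d) (hU : IsUpperSet U) (hr : 0 ≤ r) (hr1 : r ≤ 1)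
    {w : Vertex d} {a : Fin d} (hw : a :: w <:+ v) : pathVal U v w ≤ upVal U v L r w a := by
  have hd' : (2 : ℝ) ≤ d := by exact_mod_cast hd
  induction w generalizing a with
  | nil => exact le_rfl
  | cons b w ih =>
    have hw' : b :: w <:+ v := (List.suffix_cons a _).trans hw
    have h1 := (pathVal_mono hU (treePath_subset_parent hw')).trans (ih hw')
    have h2 : pathVal U v (b :: w) ≤
        (∑ i ∈ Finset.univ.erase a, downVal U v L (i :: b :: w)) / (d - 1) := by
      rw [le_div_iff₀ (by linarith)]
      calc pathVal U v (b :: w) * (d - 1)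
          = ∑ _i ∈ Finset.univ.erase a, pathVal U v (b :: w) := by
            simp [Finset.card_erase_of_mem, Nat.cast_sub (show 1 ≤ d by omega), mul_comm]
        _ ≤ _ := Finset.sum_le_sum fun i hi => by
            have hn := child_not_suffix hw (Finset.ne_of_mem_erase hi)
            exact (pathVal_mono hU (treePath_subset_child hn)).trans
              (pathVal_le_downVal hd hU fun j hj => hn ((List.suffix_cons j _).trans hj))
    rw [upVal]
    nlinarith

theorem upVal_mem (hd : 2 ≤ d) (hr : 0 ≤ r) (hr1 : r ≤ 1) (w : Vertex d) (a : Fin d) :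
    0 ≤ upVal U v L r w a ∧ upVal U v L r w a ≤ 1 := by
  have hd' : (2 : ℝ) ≤ d := by exact_mod_cast hd
  induction w generalizing a with
  | nil => exact ⟨pathVal_nonneg _, pathVal_le_one _⟩
  | cons b w ih =>
    have h1 : 0 ≤ (∑ i ∈ Finset.univ.erase a, downVal U v L (i :: b :: w)) / ((d : ℝ) - 1) :=
      div_nonneg (Finset.sum_nonneg fun i _ => (downVal_mem hd _).1) (by linarith)
    have h2 : (∑ i ∈ Finset.univ.erase a, downVal U v L (i :: b :: w)) / ((d : ℝ) - 1) ≤ 1 := by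
      rw [div_le_one (by linarith)]
      calc _ ≤ ∑ _i ∈ Finset.univ.erase a, (1 : ℝ) :=
            Finset.sum_le_sum fun i _ => (downVal_mem hd _).2
        _ = d - 1 := by simp [Finset.card_erase_of_mem, Nat.cast_sub (show 1 ≤ d by omega)]
    have := ih b
    rw [upVal]
    constructor
    · have := mul_nonneg hr this.1
      have := mul_nonneg (sub_nonneg.2 hr1) h1
      linarith
    · nlinarith [mul_le_mul_of_nonneg_left this.2 hr,
        mul_le_mul_of_nonneg_left h2 (sub_nonneg.2 hr1)]

end Values

/-- An increasing sequence of sets whose union is in a local family enters the family. -/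
theorem IsLocalFamily.exists_mem {d : ℕ} {U : Set (Set (Vertex d))} {L : ℕ}
    (hU : IsLocalFamily U L) {R : ℕ → Set (Vertex d)} (hR : Monotone R)
    (h : {u | ∃ t, u ∈ R t} ∈ U) : ∃ t, R t ∈ U := by
  classical
  have hfin : {v : Vertex d | v.length ≤ L}.Finite := List.finite_length_le (Fin d) L
  have hex : ∀ u : Vertex d, ∃ t, (∃ s, u ∈ R s) → u ∈ R t := fun u => by
    by_cases h : ∃ s, u ∈ R s
    · exact h.imp fun s hs _ => hs
    · exact ⟨0, fun h' => absurd h' h⟩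
  choose T hT using hex
  obtain ⟨t, ht⟩ := (hfin.image T).bddAbove
  refine ⟨t, (hU {u | ∃ t, u ∈ R t} (R t) fun u hu => ⟨fun h => ?_, fun h => ⟨t, h⟩⟩).1 h⟩
  exact hR (ht (Set.mem_image_of_mem T (show u.length ≤ L from hu))) (hT u h)

/-- Almost surely all driving states of a chain are possible steps. -/
theorem ae_chainNoise {S : Type} [MeasurableSpace S] [Countable S] [DiscreteMeasurableSpace S]
    {step : S → Measure S} [∀ x, IsProbabilityMeasure (step x)] {N : S → S → Prop}
    (h : ∀ x, ∀ᵐ y ∂step x, N x y) : ∀ᵐ ω ∂chainNoise step, ∀ k x, N x (ω (k, x)) := by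
  refine ae_all_iff.2 fun k => ae_all_iff.2 fun x => ?_
  exact (measurePreserving_eval_infinitePi (fun i : ℕ × S => step i.2)
    (k, x)).quasiMeasurePreserving.ae (h x)

/-- Weighted sums of real values, in the extended nonnegative reals. -/
theorem sum_ofReal_mul {ι : Type} (s : Finset ι) {c : ℝ} (hc : 0 ≤ c) {f : ι → ℝ}
    (hf : ∀ i, 0 ≤ f i) :
    ∑ i ∈ s, ENNReal.ofReal c * ENNReal.ofReal (f i) = ENNReal.ofReal (∑ i ∈ s, c * f i) := by
  rw [ENNReal.ofReal_sum_of_nonneg fun i _ => mul_nonneg hc (hf i)]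
  exact Finset.sum_congr rfl fun i _ => (ENNReal.ofReal_mul hc).symm

/-! ### The range of a non-backtracking frog -/

instance (d : ℕ) : Countable (NBState d) := by
  let f : NBState d → ℕ × Vertex d × List (Fin d)
    | .fresh v => (0, v, [])
    | .up v a => (1, v, [a])
    | .down v => (2, v, [])
    | .gone => (3, [], [])
  refine Function.Injective.countable (f := f) ?_
  rintro (v | ⟨v, a⟩ | v | _) (w | ⟨w, b⟩ | w | _) h <;> simp_all [f]

/-- The possible steps of a non-backtracking frog. -/
def NBNext {d : ℕ} : NBState d → NBState d → Prop
  | .fresh [], s => ∃ i, s = .down [i]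
  | .fresh (a :: v), s => s = .up v a ∨ ∃ i, s = .down (i :: a :: v)
  | .up [] _, s => s = .gone
  | .up (b :: v) a, s => s = .up v b ∨ ∃ i, i ≠ a ∧ s = .down (i :: b :: v)
  | .down v, s => ∃ i, s = .down (i :: v)
  | .gone, s => s = .gone

theorem ae_nbStep {d : ℕ} (q : ℝ) (s : NBState d) : ∀ᵐ s' ∂nbStep d q s, NBNext s s' := by
  rw [ae_iff]
  rcases s with (_ | ⟨a, v⟩) | ⟨_ | ⟨b, v⟩, a⟩ | v | _ <;>
    simp [nbStep, NBNext]
  intro i h1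
  exact Or.inr h1

/-- The value of the states of a non-backtracking frog started at `v`. -/
noncomputable def nbVal {d : ℕ} (U : Set (Set (Vertex d))) (v : Vertex d) (L : ℕ) (q r : ℝ) :
    NBState d → ℝ
  | .fresh [] => downVal U v L []
  | .fresh (a :: w) => q * upVal U v L r w a + (1 - q) * downVal U v L (a :: w)
  | .up w a => upVal U v L r w a
  | .down w => downVal U v L w
  | .gone => pathVal U v []

/-- The set of vertices visited by a non-backtracking frog up to time `t`. -/
def nbRange {d : ℕ} (v : Vertex d) (ω : ℕ × NBState d → NBState d) (t : ℕ) : Set (Vertex d) :=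
  {u | ∃ k ≤ t, (traj (.fresh v) ω k).pos = some u}

theorem nbRange_succ {d : ℕ} (v : Vertex d) (ω : ℕ × NBState d → NBState d) (t : ℕ) :
    nbRange v ω (t + 1) =
      nbRange v ω t ∪ {u | (traj (.fresh v) ω (t + 1)).pos = some u} := by
  ext u
  constructor
  · rintro ⟨k, hk, h⟩
    rcases Nat.le_succ_iff.1 hk with hk | rfl
    · exact Or.inl ⟨k, hk, h⟩
    · exact Or.inr h
  · rintro (⟨k, hk, h⟩ | h)
    · exact ⟨k, hk.trans (Nat.le_succ t), h⟩
    · exact ⟨t + 1, le_rfl, h⟩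

/-- The range of a non-backtracking frog is contained in the geodesic to its position. -/
def NBInv {d : ℕ} (v : Vertex d) (R : Set (Vertex d)) : NBState d → Prop
  | .fresh w => w = v ∧ R ⊆ treePath v v
  | .up w a => a :: w <:+ v ∧ R ⊆ treePath v w
  | .down w => ¬ w <:+ v ∧ R ⊆ treePath v w
  | .gone => R ⊆ treePath v []

/-- Every non-backtracking step moves away from `v`. Remembering in `up w a` that `a :: w` is an
ancestor of `v`, and in `down w` that `w` is not, is what keeps this true at the next step. -/
theorem nbInv_step {d : ℕ} {v : Vertex d} {R : Set (Vertex d)} {s s' : NBState d}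
    (h : NBInv v R s) (hs : NBNext s s') : NBInv v (R ∪ {u | s'.pos = some u}) s' := by
  have hsing : ∀ w : Vertex d, {u | some w = some u} = {w} := fun w => by
    ext u; simp [eq_comm]
  have hdown : ∀ (w : Vertex d) (i : Fin d), ¬ i :: w <:+ v → R ⊆ treePath v w →
      NBInv v (R ∪ {u | (NBState.down (i :: w)).pos = some u}) (.down (i :: w)) := by
    intro w i hn hR
    refine ⟨hn, ?_⟩
    simp only [NBState.pos, hsing]
    exact Set.union_subset (hR.trans (treePath_subset_child hn))
      (Set.singleton_subset_iff.2 (mem_treePath_right _ _))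
  have hup : ∀ (w : Vertex d) (a : Fin d), a :: w <:+ v → R ⊆ treePath v (a :: w) →
      NBInv v (R ∪ {u | (NBState.up w a).pos = some u}) (.up w a) := by
    intro w a hn hR
    refine ⟨hn, ?_⟩
    simp only [NBState.pos, hsing]
    exact Set.union_subset (hR.trans (treePath_subset_parent hn))
      (Set.singleton_subset_iff.2 (mem_treePath_right _ _))
  rcases s with (_ | ⟨a, w⟩) | ⟨_ | ⟨b, w⟩, a⟩ | w | _
  · obtain ⟨i, rfl⟩ := hs
    obtain ⟨rfl, hR⟩ := h
    exact hdown _ _ (by simp) hR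
  · obtain ⟨rfl, hR⟩ := h
    rcases hs with rfl | ⟨i, rfl⟩
    · exact hup _ _ List.suffix_rfl hR
    · exact hdown _ _ (fun h => by simpa using h.length_le) hR
  · obtain rfl := hs
    simpa [NBInv, NBState.pos] using h.2
  · rcases hs with rfl | ⟨i, hi, rfl⟩
    · exact hup _ _ ((List.suffix_cons _ _).trans h.1) h.2
    · exact hdown _ _ (child_not_suffix h.1 hi) h.2
  · obtain ⟨i, rfl⟩ := hs
    exact hdown _ _ (fun h' => h.1 ((List.suffix_cons _ _).trans h')) h.2
  · obtain rfl := hs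
    simpa [NBInv, NBState.pos] using h

theorem nbInv_traj {d : ℕ} {v : Vertex d} {ω : ℕ × NBState d → NBState d}
    (hω : ∀ k s, NBNext s (ω (k, s))) (t : ℕ) :
    NBInv v (nbRange v ω t) (traj (.fresh v) ω t) := by
  induction t with
  | zero =>
    refine ⟨rfl, ?_⟩
    rintro u ⟨k, hk, h⟩
    obtain rfl : k = 0 := by omega
    simp only [traj, NBState.pos, Option.some.injEq] at h
    subst h
    exact mem_treePath_right _ _
  | succ t ih =>
    rw [nbRange_succ]
    exact nbInv_step ih (hω t _)

section NBVal

variable {d : ℕ} {U : Set (Set (Vertex d))} {v : Vertex d} {L : ℕ} {q r : ℝ}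

/-- The martingale property is exact in every state, because `upVal` and `downVal` satisfy the
recursions of the step laws when `r` is `upAgain d q`. -/
theorem lintegral_nbVal (hd : 2 ≤ d) (hU : IsLocalFamily U L) (hv : v.length ≤ L)
    (hq : 0 ≤ q) (hq1 : q ≤ 1) (s : NBState d) :
    ∫⁻ s', ENNReal.ofReal (nbVal U v L q (upAgain d q) s') ∂nbStep d q s =
      ENNReal.ofReal (nbVal U v L q (upAgain d q) s) := by
  have hd' : (2 : ℝ) ≤ d := by exact_mod_cast hd
  obtain ⟨hr, hr1⟩ := upAgain_mem hd hq hq1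
  have hD : ∀ w : Vertex d, 0 ≤ downVal U v L w := fun w => (downVal_mem hd w).1
  have hQ : ∀ (w : Vertex d) a, 0 ≤ upVal U v L (upAgain d q) w a :=
    fun w a => (upVal_mem hd hr hr1 w a).1
  have hd0 : (0 : ℝ) ≤ 1 / d := by positivity
  have hq0 : (0 : ℝ) ≤ (1 - q) / d := div_nonneg (by linarith) (by positivity)
  have hr0 : (0 : ℝ) ≤ (1 - upAgain d q) / (d - 1) := div_nonneg (by linarith) (by linarith)
  rcases s with (_ | ⟨a, w⟩) | ⟨_ | ⟨b, w⟩, a⟩ | w | _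
  · simp only [nbStep, lintegral_finsetSum_measure, lintegral_smul_measure, lintegral_dirac,
      smul_eq_mul, nbVal]
    rw [sum_ofReal_mul _ hd0 fun i => hD _, downVal_eq hd hU hv [], ← Finset.mul_sum,
      one_div_mul_eq_div]
  · simp only [nbStep, lintegral_add_measure, lintegral_finsetSum_measure,
      lintegral_smul_measure, lintegral_dirac, smul_eq_mul, nbVal]
    rw [sum_ofReal_mul _ hq0 fun i => hD _, ← ENNReal.ofReal_mul hq,
      ← ENNReal.ofReal_add (mul_nonneg hq (hQ _ _))
        (Finset.sum_nonneg fun i _ => mul_nonneg hq0 (hD _)),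
      downVal_eq hd hU hv (a :: w), ← Finset.mul_sum, div_mul_eq_mul_div, mul_div_assoc]
  · simp only [nbStep, lintegral_dirac, nbVal, upVal]
  · simp only [nbStep, lintegral_add_measure, lintegral_finsetSum_measure,
      lintegral_smul_measure, lintegral_dirac, smul_eq_mul, nbVal]
    rw [sum_ofReal_mul _ hr0 fun i => hD _, ← ENNReal.ofReal_mul hr,
      ← ENNReal.ofReal_add (mul_nonneg hr (hQ _ _))
        (Finset.sum_nonneg fun i _ => mul_nonneg hr0 (hD _)),
      ← Finset.mul_sum, div_mul_eq_mul_div, mul_div_assoc, upVal]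
  · simp only [nbStep, lintegral_finsetSum_measure, lintegral_smul_measure, lintegral_dirac,
      smul_eq_mul, nbVal]
    rw [sum_ofReal_mul _ hd0 fun i => hD _, downVal_eq hd hU hv w, ← Finset.mul_sum,
      one_div_mul_eq_div]
  · simp only [nbStep, lintegral_dirac]

/-- The range lies in the current geodesic, which is therefore in `U`; the value averages indicators
of geodesics that are at least as large. -/
theorem one_le_nbVal (hd : 2 ≤ d) (hU : IsUpperSet U)
    (hq : 0 ≤ q) (hq1 : q ≤ 1) (hr : 0 ≤ r) (hr1 : r ≤ 1) {R : Set (Vertex d)} (hR : R ∈ U)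
    {s : NBState d} (h : NBInv v R s) : 1 ≤ nbVal U v L q r s := by
  have h1 : ∀ w, R ⊆ treePath v w → pathVal U v w = 1 := fun w hw => if_pos (hU hw hR)
  rcases s with (_ | ⟨a, w⟩) | ⟨w, a⟩ | w | _
  · obtain ⟨rfl, h⟩ := h
    rw [← h1 _ h]
    exact pathVal_le_downVal hd hU fun i => by simp
  · obtain ⟨rfl, h⟩ := h
    have h2 := pathVal_le_upVal (L := L) hd hU hr hr1 (v := a :: w) (w := w) List.suffix_rfl
    have h3 := pathVal_le_downVal (L := L) hd hU (v := a :: w) (w := a :: w)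
      fun i h => by simpa using h.length_le
    rw [h1 _ h] at h3
    rw [h1 _ (h.trans (treePath_subset_parent List.suffix_rfl))] at h2
    rw [nbVal]
    nlinarith
  · rw [← h1 _ h.2]
    exact pathVal_le_upVal hd hU hr hr1 h.1
  · rw [← h1 _ h.2]
    exact pathVal_le_downVal hd hU fun i hi => h.1 ((List.suffix_cons _ _).trans hi)
  · exact (h1 _ h).ge

/-- The value at the start bounds the probability that the range is in `U`. -/
theorem chainNoise_nbRange_le (hd : 2 ≤ d) (hU : IsUpperSet U) (hL : IsLocalFamily U L)
    (hv : v.length ≤ L) (hq : 0 ≤ q) (hq1 : q ≤ 1) :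
    chainNoise (nbStep d q) {ω | {u | ∃ k, (traj (.fresh v) ω k).pos = some u} ∈ U} ≤
      ENNReal.ofReal (nbVal U v L q (upAgain d q) (.fresh v)) := by
  have := isProbabilityMeasure_nbStep hd hq hq1
  have := isProbabilityMeasure_chainNoise (nbStep d q)
  obtain ⟨hr, hr1⟩ := upAgain_mem hd hq hq1
  set Φ : NBState d → ℝ := nbVal U v L q (upAgain d q) with hΦ
  have hmart : ∀ t, ∫⁻ ω, ENNReal.ofReal (Φ (traj (.fresh v) ω t)) ∂chainNoise (nbStep d q) =
      ENNReal.ofReal (Φ (.fresh v)) := by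
    intro t
    induction t with
    | zero => simp [traj]
    | succ t ih =>
      have h := setLIntegral_traj_succ (nbStep d q) (.fresh v) t
        (@MeasurableSet.univ _ (chainPast (NBState d) t)) fun s => ENNReal.ofReal (Φ s)
      rw [setLIntegral_univ, setLIntegral_univ] at h
      rw [h, ← ih]
      exact lintegral_congr fun ω => lintegral_nbVal hd hL hv hq hq1 _
  have hmono : ∀ ω : ℕ × NBState d → NBState d, Monotone (nbRange v ω) :=
    fun ω s t hst u ⟨k, hk, h⟩ => ⟨k, hk.trans hst, h⟩
  -- Locality: if the full range is in `U`, so is the range up to some finite time, where the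
  -- martingale can be evaluated.
  have hsub : {ω : ℕ × NBState d → NBState d |
      {u | ∃ k, (traj (.fresh v) ω k).pos = some u} ∈ U} ⊆ ⋃ t, {ω | nbRange v ω t ∈ U} := by
    intro ω hω
    refine Set.mem_iUnion.2 (hL.exists_mem (hmono ω) ?_)
    have e : {u | ∃ t, u ∈ nbRange v ω t} = {u | ∃ k, (traj (.fresh v) ω k).pos = some u} :=
      Set.ext fun u => ⟨fun ⟨t, k, _, h⟩ => ⟨k, h⟩, fun ⟨k, h⟩ => ⟨k, k, le_rfl, h⟩⟩
    rw [e]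
    exact hω
  refine (measure_mono hsub).trans ?_
  have hmonoU : Monotone fun t => {ω : ℕ × NBState d → NBState d | nbRange v ω t ∈ U} :=
    fun s t hst ω hω => hU (hmono ω hst) hω
  rw [hmonoU.measure_iUnion]
  refine iSup_le fun t => ?_
  rw [← hmart t]
  have hae := ae_chainNoise (ae_nbStep (d := d) q)
  calc chainNoise (nbStep d q) {ω | nbRange v ω t ∈ U}
      ≤ chainNoise (nbStep d q) {ω | 1 ≤ ENNReal.ofReal (Φ (traj (.fresh v) ω t))} := by
        refine measure_mono_ae ?_
        filter_upwards [hae] with ω hω hR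
        exact ENNReal.one_le_ofReal.2 (one_le_nbVal hd hU hq hq1 hr hr1 hR (nbInv_traj hω t))
    _ ≤ _ := by
        have hm : Measurable fun ω : ℕ × NBState d → NBState d =>
            ENNReal.ofReal (Φ (traj (.fresh v) ω t)) :=
          (Measurable.of_discrete (f := fun s => ENNReal.ofReal (Φ s))).comp (measurable_traj _ t)
        simpa using mul_meas_ge_le_lintegral hm 1

end NBVal

/-! ### The range of a frog in the frog model -/

/-- The possible steps of a frog in the frog model. -/
def FMNext {d : ℕ} (w w' : Vertex d) : Prop :=
  (∃ i, w' = i :: w) ∨ ∃ a, w = a :: w'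

theorem ae_fmStep {d : ℕ} (p : ℝ) (w : Vertex d) : ∀ᵐ w' ∂fmStep d p w, FMNext w w' := by
  rw [ae_iff]
  rcases w with _ | ⟨a, v⟩ <;> simp [fmStep, FMNext]

/-- The set of vertices visited up to time `t`. -/
def fmRange {d : ℕ} (v : Vertex d) (ω : ℕ × Vertex d → Vertex d) (t : ℕ) : Set (Vertex d) :=
  {u | ∃ k ≤ t, traj v ω k = u}

theorem fmRange_mono {d : ℕ} (v : Vertex d) (ω : ℕ × Vertex d → Vertex d) :
    Monotone (fmRange v ω) :=
  fun _ _ hst _ ⟨k, hk, h⟩ => ⟨k, hk.trans hst, h⟩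

/-- A nearest-neighbour path in a tree covers the geodesic between its endpoints. -/
theorem treePath_subset_fmRange {d : ℕ} {v : Vertex d} {ω : ℕ × Vertex d → Vertex d}
    (hω : ∀ k w, FMNext w (ω (k, w))) (t : ℕ) : treePath v (traj v ω t) ⊆ fmRange v ω t := by
  induction t with
  | zero =>
    rw [traj, treePath_self]
    rintro _ rfl
    exact ⟨0, le_rfl, rfl⟩
  | succ t ih =>
    have hstep : treePath v (traj v ω (t + 1)) ⊆
        insert (traj v ω (t + 1)) (treePath v (traj v ω t)) := by
      rcases hω t (traj v ω t) with ⟨i, hi⟩ | ⟨a, ha⟩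
      · have hi' : traj v ω (t + 1) = i :: traj v ω t := hi
        rw [hi']
        exact treePath_child_subset _ _ _
      · have ha' : traj v ω t = a :: traj v ω (t + 1) := ha
        rw [ha']
        exact treePath_parent_subset _ _ _
    exact hstep.trans (Set.insert_subset ⟨t + 1, le_rfl, rfl⟩
      (ih.trans (fmRange_mono v ω (Nat.le_succ t))))

theorem measurableSet_fmRange {d : ℕ} (v : Vertex d) (t : ℕ) (U : Set (Set (Vertex d))) :
    MeasurableSet[chainPast (Vertex d) t] {ω | fmRange v ω t ∈ U} := by
  have h := measurableSet_chainPast v t {x : Fin (t + 1) → Vertex d | Set.range x ∈ U}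
  have e : ∀ ω : ℕ × Vertex d → Vertex d,
      Set.range (fun k : Fin (t + 1) => traj v ω k) = fmRange v ω t := by
    intro ω
    ext u
    constructor
    · rintro ⟨k, rfl⟩
      exact ⟨k, Nat.lt_succ_iff.1 k.2, rfl⟩
    · rintro ⟨k, hk, rfl⟩
      exact ⟨⟨k, Nat.lt_succ_iff.2 hk⟩, rfl⟩
  simp only [Set.mem_ofPred_eq, e] at h
  exact h

/-- One step of a frog, applied to a nonnegative function: the root. -/
theorem lintegral_fmStep_nil {d : ℕ} (p : ℝ) {f : Vertex d → ℝ} (hf : ∀ w, 0 ≤ f w) :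
    ∫⁻ w, ENNReal.ofReal (f w) ∂fmStep d p [] =
      ENNReal.ofReal (∑ i : Fin d, 1 / d * f [i]) := by
  simp only [fmStep, lintegral_finsetSum_measure, lintegral_smul_measure, lintegral_dirac,
    smul_eq_mul]
  exact sum_ofReal_mul _ (by positivity) fun i => hf _

/-- One step of a frog, applied to a nonnegative function: other vertices. -/
theorem lintegral_fmStep_cons {d : ℕ} {p : ℝ} (h0 : 0 ≤ p) (h1 : p ≤ 1) {f : Vertex d → ℝ}
    (hf : ∀ w, 0 ≤ f w) (a : Fin d) (v : Vertex d) :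
    ∫⁻ w, ENNReal.ofReal (f w) ∂fmStep d p (a :: v) =
      ENNReal.ofReal (p * f v + ∑ i : Fin d, (1 - p) / d * f (i :: a :: v)) := by
  have hc : 0 ≤ (1 - p) / d := div_nonneg (by linarith) (by positivity)
  simp only [fmStep, lintegral_add_measure, lintegral_finsetSum_measure, lintegral_smul_measure,
    lintegral_dirac, smul_eq_mul]
  rw [sum_ofReal_mul _ hc fun i => hf _, ← ENNReal.ofReal_mul h0,
    ← ENNReal.ofReal_add (mul_nonneg h0 (hf _))
      (Finset.sum_nonneg fun i _ => mul_nonneg hc (hf _))]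

/-- Geometric decay of the exponential moment of the level of a transient walk. -/
theorem lintegral_pow_length_le {d : ℕ} (hd : 2 ≤ d) {p : ℝ} (h0 : 0 ≤ p) (h1 : p ≤ 1)
    {ρ κ : ℝ} (hρ : 0 < ρ) (hρκ : ρ ≤ κ) (hκ : p + (1 - p) * ρ ^ 2 ≤ κ * ρ) (v : Vertex d)
    (t : ℕ) : ∫⁻ ω, ENNReal.ofReal (ρ ^ (traj v ω t).length) ∂chainNoise (fmStep d p) ≤
      ENNReal.ofReal (κ ^ t * ρ ^ v.length) := by
  have := isProbabilityMeasure_fmStep hd h0 h1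
  have := isProbabilityMeasure_chainNoise (fmStep d p)
  have hd' : (d : ℝ) ≠ 0 := by positivity
  have hκ0 : 0 ≤ κ := hρ.le.trans hρκ
  induction t with
  | zero => simp [traj]
  | succ t ih =>
    have h := setLIntegral_traj_succ (fmStep d p) v t
      (@MeasurableSet.univ _ (chainPast (Vertex d) t)) fun w => ENNReal.ofReal (ρ ^ w.length)
    rw [setLIntegral_univ, setLIntegral_univ] at h
    rw [h]
    have hstep : ∀ w : Vertex d, ∫⁻ z, ENNReal.ofReal (ρ ^ z.length) ∂fmStep d p w ≤
        ENNReal.ofReal κ * ENNReal.ofReal (ρ ^ w.length) := by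
      intro w
      have hf : ∀ w : Vertex d, 0 ≤ ρ ^ w.length := fun w => by positivity
      rw [← ENNReal.ofReal_mul hκ0]
      rcases w with _ | ⟨a, w⟩
      · rw [lintegral_fmStep_nil p hf]
        refine ENNReal.ofReal_le_ofReal ?_
        simp [hd', hρκ]
      · rw [lintegral_fmStep_cons h0 h1 hf]
        refine ENNReal.ofReal_le_ofReal ?_
        simp only [List.length_cons, Finset.sum_const, Finset.card_univ, Fintype.card_fin,
          nsmul_eq_mul]
        rw [← mul_assoc, mul_div_cancel₀ _ hd']
        have := mul_le_mul_of_nonneg_right hκ (hf w)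
        calc _ = (p + (1 - p) * ρ ^ 2) * ρ ^ w.length := by ring
          _ ≤ _ := this
          _ = _ := by ring
    calc _ ≤ ∫⁻ ω, ENNReal.ofReal κ * ENNReal.ofReal (ρ ^ (traj v ω t).length)
          ∂chainNoise (fmStep d p) := lintegral_mono fun ω => hstep _
      _ = ENNReal.ofReal κ * ∫⁻ ω, ENNReal.ofReal (ρ ^ (traj v ω t).length)
          ∂chainNoise (fmStep d p) := lintegral_const_mul' _ _ ENNReal.ofReal_ne_top
      _ ≤ ENNReal.ofReal κ * ENNReal.ofReal (κ ^ t * ρ ^ v.length) := by gcongr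
      _ = _ := by rw [← ENNReal.ofReal_mul hκ0, pow_succ]; congr 1; ring

section FMRange

variable {d : ℕ} {U : Set (Set (Vertex d))} {v : Vertex d} {L : ℕ} {p r : ℝ}

theorem lintegral_walkVal (hd : 2 ≤ d) (hU : IsLocalFamily U L) (hv : v.length ≤ L)
    (h0 : 0 ≤ p) (h1 : p ≤ 1) (hr : 0 ≤ r) (hr1 : r ≤ 1) (hp : r * (1 - p) = p) {w : Vertex d}
    (hw : treePath v w ∉ U) :
    ∫⁻ z, ENNReal.ofReal (walkVal U v L r z) ∂fmStep d p w =
      ENNReal.ofReal (walkVal U v L r w) := by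
  have hf : ∀ w, 0 ≤ walkVal U v L r w := fun w => (walkVal_mem hd hr hr1 w).1
  rcases w with _ | ⟨a, w⟩
  · rw [lintegral_fmStep_nil p hf, ← walkVal_nil hd hU hv hw]
  · rw [lintegral_fmStep_cons h0 h1 hf, ← walkVal_cons hd hU hv hp]

/-- The value is a submartingale up to the first time the range is in `U`. -/
theorem walkVal_le (hd : 2 ≤ d) (hU : IsUpperSet U) (hL : IsLocalFamily U L)
    (hv : v.length ≤ L) (h0 : 0 ≤ p) (h1 : p ≤ 1) (hr : 0 ≤ r) (hr1 : r ≤ 1)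
    (hp : r * (1 - p) = p) (t : ℕ) :
    ENNReal.ofReal (walkVal U v L r v) ≤
      chainNoise (fmStep d p) {ω | fmRange v ω t ∈ U} +
        ∫⁻ ω in {ω | fmRange v ω t ∈ U}ᶜ, ENNReal.ofReal (walkVal U v L r (traj v ω t))
          ∂chainNoise (fmStep d p) := by
  have := isProbabilityMeasure_fmStep hd h0 h1
  have := isProbabilityMeasure_chainNoise (fmStep d p)
  set μ := chainNoise (fmStep d p) with hμ
  have hle1 : ∀ w, ENNReal.ofReal (walkVal U v L r w) ≤ 1 := fun w => by
    rw [ENNReal.ofReal_le_one]; exact (walkVal_mem hd hr hr1 w).2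
  have hm : ∀ t, MeasurableSet {ω : ℕ × Vertex d → Vertex d | fmRange v ω t ∈ U} :=
    fun t => chainPast_le t _ (measurableSet_fmRange v t U)
  induction t with
  | zero =>
    have e : ∀ ω : ℕ × Vertex d → Vertex d, fmRange v ω 0 = {v} := fun ω => by
      ext u
      constructor
      · rintro ⟨k, hk, h⟩
        obtain rfl : k = 0 := by omega
        exact h.symm
      · rintro rfl
        exact ⟨0, le_rfl, rfl⟩
    simp only [e, traj]
    by_cases h : ({v} : Set (Vertex d)) ∈ U
    · simpa [h] using hle1 v
    · simp [h]
  | succ t ih =>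
    refine ih.trans ?_
    set A := {ω : ℕ × Vertex d → Vertex d | fmRange v ω t ∈ U} with hA
    set B := {ω : ℕ × Vertex d → Vertex d | fmRange v ω (t + 1) ∈ U} with hB
    have hAB : A ⊆ B := fun ω hω => hU (fmRange_mono v ω (Nat.le_succ t)) hω
    have hae := ae_chainNoise (ae_fmStep (d := d) p)
    -- While the range is outside `U`, so is the geodesic it contains, and `walkVal` is harmonic at
    -- the current position, even at the root.
    have e1 : ∫⁻ ω in Aᶜ, ENNReal.ofReal (walkVal U v L r (traj v ω t)) ∂μ =
        ∫⁻ ω in Aᶜ, ENNReal.ofReal (walkVal U v L r (traj v ω (t + 1))) ∂μ := by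
      rw [setLIntegral_traj_succ (fmStep d p) v t
        (@MeasurableSet.compl _ _ (chainPast (Vertex d) t) (measurableSet_fmRange v t U))
        fun w => ENNReal.ofReal (walkVal U v L r w)]
      refine setLIntegral_congr_fun_ae (hm t).compl ?_
      filter_upwards [hae] with ω hω hωA
      exact (lintegral_walkVal hd hL hv h0 h1 hr hr1 hp
        fun h => hωA (hU (treePath_subset_fmRange hω t) h)).symm
    have e2 : Aᶜ = (B \ A) ∪ Bᶜ := by
      ext ω
      by_cases hω : ω ∈ B
      · simp [hω]
      · simpa [hω] using fun h => hω (hAB h)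
    have e3 : ∫⁻ ω in B \ A, ENNReal.ofReal (walkVal U v L r (traj v ω (t + 1))) ∂μ ≤
        μ (B \ A) := by
      calc _ ≤ ∫⁻ ω in B \ A, 1 ∂μ := lintegral_mono fun ω => hle1 _
        _ = _ := by simp
    have e4 : μ A + μ (B \ A) = μ B := by
      rw [← measure_union Set.disjoint_sdiff_right ((hm _).diff (hm t)),
        Set.union_sdiff_cancel hAB]
    rw [e1, e2, ← e4, add_assoc]
    gcongr
    refine (lintegral_union_le _ _ _).trans ?_
    gcongr

/-- The value at the start is a lower bound for the probability that the range of a transient walk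
is in `U`. -/
theorem walkVal_le_chainNoise (hd : 2 ≤ d) (hU : IsUpperSet U) (hL : IsLocalFamily U L)
    (hv : v.length ≤ L) (h0 : 0 ≤ p) (h1 : p < 1 / 2) (hp : r * (1 - p) = p) :
    ENNReal.ofReal (walkVal U v L r v) ≤
      chainNoise (fmStep d p) {ω | {u | ∃ k, traj v ω k = u} ∈ U} := by
  have hr : 0 ≤ r := by
    by_contra! h
    nlinarith
  have hr1 : r < 1 := by
    by_contra! h
    nlinarith
  have hp1 : p ≤ 1 := by linarith
  have := isProbabilityMeasure_fmStep hd h0 hp1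
  have := isProbabilityMeasure_chainNoise (fmStep d p)
  set μ := chainNoise (fmStep d p) with hμ
  -- For `r < ρ < 1` the mean of `ρ ^ level` contracts off the root, as `(1 - p) ρ ^ 2 - ρ + p = (1
  -- - p) (ρ - 1) (ρ - r)` is negative. The maximum in `κ` accounts for the root, where the level
  -- rises to `1` and the factor is `ρ`.
  set ρ : ℝ := (1 + r) / 2 with hρ
  have hρ0 : 0 < ρ := by linarith
  have hρ1 : ρ < 1 := by linarith
  have hrρ : r ≤ ρ := by linarith
  set κ : ℝ := max ρ ((p + (1 - p) * ρ ^ 2) / ρ) with hκ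
  have hκ0 : 0 ≤ κ := hρ0.le.trans (le_max_left _ _)
  have hκ1 : κ < 1 := by
    refine max_lt hρ1 ?_
    rw [div_lt_one hρ0]
    have : (1 - p) * ((1 - ρ) * (ρ - r)) > 0 := by
      refine mul_pos (by linarith) (mul_pos (by linarith) (by linarith))
    nlinarith
  have hκρ : p + (1 - p) * ρ ^ 2 ≤ κ * ρ := by
    have := le_max_right ρ ((p + (1 - p) * ρ ^ 2) / ρ)
    rwa [div_le_iff₀ hρ0] at this
  have hrest : ∀ t, ∫⁻ ω in {ω | fmRange v ω t ∈ U}ᶜ,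
      ENNReal.ofReal (walkVal U v L r (traj v ω t)) ∂μ ≤
        ENNReal.ofReal ((ρ ^ L)⁻¹ * ρ ^ v.length * κ ^ t) := by
    intro t
    have hae := ae_chainNoise (ae_fmStep (d := d) p)
    -- The constant `(ρ ^ L)⁻¹` absorbs the truncated subtraction in the exponent `w.length - L`.
    have hb : ∀ w, treePath v w ∉ U → walkVal U v L r w ≤ (ρ ^ L)⁻¹ * ρ ^ w.length := by
      intro w hw
      refine (walkVal_le_pow hd hL hv hr hr1.le (if_neg hw)).trans ?_
      refine (pow_le_pow_left₀ hr hrρ _).trans ?_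
      rw [le_inv_mul_iff₀ (by positivity), ← pow_add]
      exact pow_le_pow_of_le_one hρ0.le hρ1.le (by omega)
    calc _ ≤ ∫⁻ ω in {ω | fmRange v ω t ∈ U}ᶜ,
          ENNReal.ofReal (ρ ^ L)⁻¹ * ENNReal.ofReal (ρ ^ (traj v ω t).length) ∂μ := by
          refine setLIntegral_mono_ae' (chainPast_le t _ (measurableSet_fmRange v t U)).compl ?_
          filter_upwards [hae] with ω hω hωA
          rw [← ENNReal.ofReal_mul (by positivity)]
          exact ENNReal.ofReal_le_ofReal
            (hb _ fun h => hωA (hU (treePath_subset_fmRange hω t) h))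
      _ ≤ ∫⁻ ω, ENNReal.ofReal (ρ ^ L)⁻¹ * ENNReal.ofReal (ρ ^ (traj v ω t).length) ∂μ :=
          setLIntegral_le_lintegral _ _
      _ = ENNReal.ofReal (ρ ^ L)⁻¹ * ∫⁻ ω, ENNReal.ofReal (ρ ^ (traj v ω t).length) ∂μ :=
          lintegral_const_mul' _ _ ENNReal.ofReal_ne_top
      _ ≤ ENNReal.ofReal (ρ ^ L)⁻¹ * ENNReal.ofReal (κ ^ t * ρ ^ v.length) := by
          gcongr
          exact lintegral_pow_length_le hd h0 hp1 hρ0 (le_max_left _ _) hκρ v t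
      _ = _ := by
          rw [← ENNReal.ofReal_mul (by positivity)]; congr 1; ring
  have hbound : ∀ t : ℕ, ENNReal.ofReal (walkVal U v L r v) ≤
      μ {ω | {u | ∃ k, traj v ω k = u} ∈ U} +
        ENNReal.ofReal ((ρ ^ L)⁻¹ * ρ ^ v.length * κ ^ t) := by
    intro t
    refine (walkVal_le hd hU hL hv h0 hp1 hr hr1.le hp t).trans (add_le_add ?_ (hrest t))
    refine measure_mono fun ω hω => hU ?_ hω
    rintro u ⟨k, _, h⟩
    exact ⟨k, h⟩
  have hlim : Filter.Tendsto (fun t : ℕ => μ {ω | {u | ∃ k, traj v ω k = u} ∈ U} +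
      ENNReal.ofReal ((ρ ^ L)⁻¹ * ρ ^ v.length * κ ^ t)) Filter.atTop
      (nhds (μ {ω | {u | ∃ k, traj v ω k = u} ∈ U} + 0)) := by
    refine tendsto_const_nhds.add ?_
    rw [← ENNReal.ofReal_zero]
    refine ENNReal.tendsto_ofReal ?_
    simpa using (tendsto_pow_atTop_nhds_zero_of_lt_one hκ0 hκ1).const_mul
      ((ρ ^ L)⁻¹ * ρ ^ v.length)
  rw [add_zero] at hlim
  exact ge_of_tendsto' hlim hbound

end FMRange

/-- The range of a frog in the frog model dominates the range of a non-backtracking frog. -/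
theorem chainNoise_nbRange_le_fmRange {d : ℕ} (hd : 2 ≤ d) {p : ℝ} (h0 : 0 ≤ p) (h1 : p < 1 / 2)
    {U : Set (Set (Vertex d))} {L : ℕ} {v : Vertex d} (hU : IsUpperSet U)
    (hL : IsLocalFamily U L) (hv : v.length ≤ L) :
    chainNoise (nbStep d (p * (d - 1) / (d - (d + 1) * p)))
        {ω | {u | ∃ k, (traj (.fresh v) ω k).pos = some u} ∈ U} ≤
      chainNoise (fmStep d p) {ω | {u | ∃ k, traj v ω k = u} ∈ U} := by
  have hd' : (2 : ℝ) ≤ d := by exact_mod_cast hd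
  obtain ⟨hα0, hα1⟩ := pStar_mem hd h0 h1.le
  have hden : (d : ℝ) - p * (d + 1) ≠ 0 := by nlinarith
  set α : ℝ := p * (d - 1) / (d - (d + 1) * p) with hα
  -- With `α = p*`, the chance to continue upwards equals the chance that the walk ever reaches its
  -- parent.
  have hr : upAgain d α = p / (1 - p) := by
    have e : α + (1 - α) * (d - 1) / d = (1 - p) * (d - 1) / (d - (d + 1) * p) := by
      rw [hα]
      field_simp
      ring
    rw [upAgain, e, hα]
    have : (d : ℝ) - 1 ≠ 0 := by linarith
    have : 1 - p ≠ 0 := by linarith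
    field_simp
  obtain ⟨hr0, hr1⟩ := upAgain_mem hd hα0 hα1
  refine (chainNoise_nbRange_le hd hU hL hv hα0 hα1).trans (le_trans ?_
    (walkVal_le_chainNoise (r := upAgain d α) hd hU hL hv h0 h1 ?_))
  · refine ENNReal.ofReal_le_ofReal ?_
    rcases v with _ | ⟨a, v⟩
    · exact le_max_right _ _
    · refine nbVal_le (β := (1 - α) / d) hd hL hr0 ?_ ?_ hα0 ?_ hv
      · field_simp
      · rw [hr, hα]
        have : 1 - p ≠ 0 := by linarith
        field_simp
        ring
      · exact div_nonneg (by linarith) (by positivity)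
  · rw [hr]
    exact div_mul_cancel₀ _ (by linarith)

/-! ### Recurrence of the walk without drift -/

/-- The walk does not visit the root in the time interval `[T, T + t]`. -/
def avoidRoot (d T t : ℕ) : Set (ℕ × Vertex d → Vertex d) :=
  {ω | ∀ k, T ≤ k → k ≤ T + t → traj [] ω k ≠ []}

section AvoidRoot

variable {d T t : ℕ}

theorem measurableSet_avoidRoot (d T t : ℕ) :
    MeasurableSet[chainPast (Vertex d) (T + t)] (avoidRoot d T t) := by
  have h := measurableSet_chainPast ([] : Vertex d) (T + t)
    {x : Fin (T + t + 1) → Vertex d | ∀ k : Fin (T + t + 1), T ≤ k.1 → x k ≠ []}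
  have e : avoidRoot d T t = {ω | (fun k : Fin (T + t + 1) => traj [] ω k) ∈
      {x : Fin (T + t + 1) → Vertex d | ∀ k : Fin (T + t + 1), T ≤ k.1 → x k ≠ []}} := by
    ext ω
    exact ⟨fun h k hk => h k hk (Nat.lt_succ_iff.1 k.2),
      fun h k hk hk' => h ⟨k, Nat.lt_succ_iff.2 hk'⟩ hk⟩
  rw [e]
  exact h

theorem avoidRoot_succ_subset : avoidRoot d T (t + 1) ⊆ avoidRoot d T t :=
  fun _ hω k hk hk' => hω k hk (by omega)

theorem traj_ne_of_mem_avoidRoot {ω : ℕ × Vertex d → Vertex d} (h : ω ∈ avoidRoot d T t) :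
    traj [] ω (T + t) ≠ [] := h _ (by omega) le_rfl

/-- A function that decreases in mean off the root gives a supermartingale before the walk visits
the root. -/
theorem setLIntegral_avoidRoot_succ (hd : 2 ≤ d) {p : ℝ} (h0 : 0 ≤ p) (h1 : p ≤ 1)
    {f g : Vertex d → ℝ} (hf : ∀ w, 0 ≤ f w) (hg : ∀ w, 0 ≤ g w)
    (h : ∀ a w, p * f w + ∑ i : Fin d, (1 - p) / d * f (i :: a :: w) + g (a :: w) ≤ f (a :: w))
    (T t : ℕ) :
    ∫⁻ ω in avoidRoot d T (t + 1), ENNReal.ofReal (f (traj [] ω (T + (t + 1))))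
        ∂chainNoise (fmStep d p) +
      ∫⁻ ω in avoidRoot d T t, ENNReal.ofReal (g (traj [] ω (T + t))) ∂chainNoise (fmStep d p) ≤
      ∫⁻ ω in avoidRoot d T t, ENNReal.ofReal (f (traj [] ω (T + t)))
        ∂chainNoise (fmStep d p) := by
  have := isProbabilityMeasure_fmStep hd h0 h1
  set μ := chainNoise (fmStep d p)
  have hm := chainPast_le _ _ (measurableSet_avoidRoot d T t)
  have e := setLIntegral_traj_succ (fmStep d p) [] (T + t) (measurableSet_avoidRoot d T t)
    fun w => ENNReal.ofReal (f w)
  have hgm : Measurable fun ω : ℕ × Vertex d → Vertex d =>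
      ENNReal.ofReal (g (traj [] ω (T + t))) :=
    (Measurable.of_discrete (f := fun w : Vertex d => ENNReal.ofReal (g w))).comp
      (measurable_traj _ _)
  calc _ ≤ ∫⁻ ω in avoidRoot d T t, ENNReal.ofReal (f (traj [] ω (T + t + 1))) ∂μ +
        ∫⁻ ω in avoidRoot d T t, ENNReal.ofReal (g (traj [] ω (T + t))) ∂μ :=
        add_le_add (lintegral_mono_set avoidRoot_succ_subset) le_rfl
    _ = ∫⁻ ω in avoidRoot d T t, (∫⁻ z, ENNReal.ofReal (f z) ∂fmStep d p (traj [] ω (T + t)) +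
          ENNReal.ofReal (g (traj [] ω (T + t)))) ∂μ := by
        rw [e, lintegral_add_right _ hgm]
    _ ≤ _ := by
        refine setLIntegral_mono' hm fun ω hω => ?_
        obtain ⟨a, w, hw⟩ := List.exists_cons_of_ne_nil (traj_ne_of_mem_avoidRoot hω)
        have hc : 0 ≤ (1 - p) / d := div_nonneg (by linarith) (by positivity)
        rw [hw, lintegral_fmStep_cons h0 h1 hf, ← ENNReal.ofReal_add (add_nonneg
          (mul_nonneg h0 (hf _)) (Finset.sum_nonneg fun i _ => mul_nonneg hc (hf _))) (hg _)]
        exact ENNReal.ofReal_le_ofReal (h a w)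

theorem length_traj_le {ω : ℕ × Vertex d → Vertex d} (hω : ∀ k w, FMNext w (ω (k, w))) (k : ℕ) :
    (traj [] ω k).length ≤ k := by
  induction k with
  | zero => simp [traj]
  | succ k ih =>
    rcases hω k (traj [] ω k) with ⟨i, hi⟩ | ⟨a, ha⟩
    · have hi' : traj [] ω (k + 1) = i :: traj [] ω k := hi
      rw [hi']
      simpa using ih
    · have ha' : traj [] ω k = a :: traj [] ω (k + 1) := ha
      rw [ha'] at ih
      simp at ih
      omega

/-- The mean level of the walk without drift, before it visits the root, is bounded. -/
theorem setLIntegral_length_le (hd : 2 ≤ d) (T t : ℕ) :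
    ∫⁻ ω in avoidRoot d T t, ENNReal.ofReal ((traj [] ω (T + t)).length : ℝ)
      ∂chainNoise (fmStep d (1 / 2)) ≤ T := by
  have := isProbabilityMeasure_fmStep hd (p := 1 / 2) (by norm_num) (by norm_num)
  have := isProbabilityMeasure_chainNoise (fmStep d (1 / 2))
  induction t with
  | zero =>
    calc _ ≤ ∫⁻ ω, ENNReal.ofReal ((traj [] ω (T + 0)).length : ℝ)
          ∂chainNoise (fmStep d (1 / 2)) := setLIntegral_le_lintegral _ _
      _ ≤ ∫⁻ _, (T : ℝ≥0∞) ∂chainNoise (fmStep d (1 / 2)) := by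
          refine lintegral_mono_ae ?_
          filter_upwards [ae_chainNoise (ae_fmStep (d := d) (1 / 2))] with ω hω
          rw [ENNReal.ofReal_natCast]
          exact_mod_cast length_traj_le hω T
      _ = T := by rw [lintegral_const, measure_univ, mul_one]
  | succ t ih =>
    -- Off the root the level is a martingale at `p = 1/2`, and at time `T` it is at most `T`.
    have h := setLIntegral_avoidRoot_succ hd (p := 1 / 2) (by norm_num) (by norm_num)
      (f := fun w : Vertex d => (w.length : ℝ)) (g := fun _ => 0) (fun w => by positivity)
      (fun w => le_rfl) (fun a w => by
        have hd' : (d : ℝ) ≠ 0 := by positivity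
        simp
        field_simp
        linarith) T t
    exact le_trans (le_trans le_self_add h) ih

/-- Until it visits the root, the walk without drift spends a bounded time on each level. -/
theorem sum_setLIntegral_pow_le (hd : 2 ≤ d) (T t : ℕ) :
    ∑ s ∈ Finset.range t, ∫⁻ ω in avoidRoot d T s,
      ENNReal.ofReal ((1 / 2) ^ (traj [] ω (T + s)).length / 4)
        ∂chainNoise (fmStep d (1 / 2)) ≤ 1 := by
  have := isProbabilityMeasure_fmStep hd (p := 1 / 2) (by norm_num) (by norm_num)
  have := isProbabilityMeasure_chainNoise (fmStep d (1 / 2))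
  have hpow : ∀ n : ℕ, ((1 : ℝ) / 2) ^ n ≤ 1 := fun n => pow_le_one₀ (by norm_num) (by norm_num)
  have key : ∑ s ∈ Finset.range t, ∫⁻ ω in avoidRoot d T s,
      ENNReal.ofReal ((1 / 2) ^ (traj [] ω (T + s)).length / 4) ∂chainNoise (fmStep d (1 / 2)) +
      ∫⁻ ω in avoidRoot d T t, ENNReal.ofReal (1 - (1 / 2) ^ (traj [] ω (T + t)).length)
        ∂chainNoise (fmStep d (1 / 2)) ≤ 1 := by
    induction t with
    | zero =>
      simp only [Finset.range_zero, Finset.sum_empty, zero_add]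
      calc _ ≤ ∫⁻ _ω in avoidRoot d T 0, 1 ∂chainNoise (fmStep d (1 / 2)) := by
            refine lintegral_mono fun ω => ENNReal.ofReal_le_one.2 ?_
            have : (0 : ℝ) ≤ (1 / 2) ^ (traj [] ω (T + 0)).length := by positivity
            linarith
        _ ≤ 1 := by rw [setLIntegral_one]; exact prob_le_one
    | succ t ih =>
      -- For `f = 1 - 2⁻ⁿ` at level `n`, a symmetric step lowers the mean by `(2ⁿ⁻¹⁻²ⁿ + 2⁻ⁿ⁻¹⁻⁰) /
      -- 2 - 2⁻ⁿ`, which is `2⁻ⁿ / 4` since the neighbouring levels contribute `2 · 2⁻ⁿ` and `2⁻ⁿ /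
      -- 2`.
      have h := setLIntegral_avoidRoot_succ hd (p := 1 / 2) (by norm_num) (by norm_num)
        (f := fun w : Vertex d => 1 - (1 / 2 : ℝ) ^ w.length)
        (g := fun w => (1 / 2) ^ w.length / 4)
        (fun w => sub_nonneg.2 (hpow _)) (fun w => by positivity) (fun a w => by
          have hd' : (d : ℝ) ≠ 0 := by positivity
          simp only [List.length_cons, Finset.sum_const, Finset.card_univ, Fintype.card_fin,
            nsmul_eq_mul, pow_succ]
          field_simp
          linarith) T t
      rw [Finset.sum_range_succ, add_assoc]
      refine le_trans ?_ ih
      gcongr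
      rw [add_comm]
      exact h
  exact le_trans le_self_add key

/-- The walk without drift visits the root after every time. -/
theorem ae_exists_traj_eq_nil (hd : 2 ≤ d) :
    ∀ᵐ ω ∂chainNoise (fmStep d (1 / 2)), ∀ T, ∃ k, T ≤ k ∧ traj [] ω k = [] := by
  have := isProbabilityMeasure_fmStep hd (p := 1 / 2) (by norm_num) (by norm_num)
  have := isProbabilityMeasure_chainNoise (fmStep d (1 / 2))
  set μ := chainNoise (fmStep d (1 / 2)) with hμ
  refine ae_all_iff.2 fun T => ?_
  rw [ae_iff]
  set q := μ {ω | ¬ ∃ k, T ≤ k ∧ traj [] ω k = []} with hq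
  have hqt : ∀ t, q ≤ μ (avoidRoot d T t) := fun t =>
    measure_mono fun ω hω k hk _ h => hω ⟨k, hk, h⟩
  have hq1 : q ≤ 1 := prob_le_one
  have hqtop : q ≠ ⊤ := ne_top_of_le_ne_top ENNReal.one_ne_top hq1
  set δ : ℕ → ℝ≥0∞ := fun s => ∫⁻ ω in avoidRoot d T s,
    ENNReal.ofReal ((1 / 2) ^ (traj [] ω (T + s)).length / 4) ∂μ with hδ
  -- Split by the level at time `T + t`: levels up to `M` are paid for by `δ t`, which tends to zero
  -- by summability, and higher levels by Markov's inequality for the bounded mean level.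
  have hone : ∀ M : ℕ, 1 ≤ M → ∀ t, q ≤ (4 * 2 ^ M : ℝ≥0∞) * δ t + T / M := by
    intro M hM t
    have hMr : (1 : ℝ) ≤ M := by exact_mod_cast hM
    have hmeas : ∀ f : Vertex d → ℝ≥0∞, Measurable fun ω : ℕ × Vertex d → Vertex d =>
        f (traj [] ω (T + t)) := fun f => (Measurable.of_discrete (f := f)).comp (measurable_traj _ _)
    calc q ≤ μ (avoidRoot d T t) := hqt t
      _ = ∫⁻ _ω in avoidRoot d T t, 1 ∂μ := by simp
      _ ≤ ∫⁻ ω in avoidRoot d T t, ((4 * 2 ^ M : ℝ≥0∞) *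
            ENNReal.ofReal ((1 / 2) ^ (traj [] ω (T + t)).length / 4) +
            (M : ℝ≥0∞)⁻¹ * ENNReal.ofReal ((traj [] ω (T + t)).length : ℝ)) ∂μ := by
          refine lintegral_mono fun ω => ?_
          set n := (traj [] ω (T + t)).length
          rcases le_total n M with hn | hn
          · refine le_trans ?_ le_self_add
            have e : (4 * 2 ^ M : ℝ≥0∞) = ENNReal.ofReal (4 * 2 ^ M) := by
              rw [ENNReal.ofReal_mul (by norm_num), ENNReal.ofReal_pow (by norm_num)]
              simp
            rw [e, ← ENNReal.ofReal_mul (by positivity), ENNReal.one_le_ofReal]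
            have h2 : (1 / 2 : ℝ) ^ M ≤ (1 / 2) ^ n :=
              pow_le_pow_of_le_one (by norm_num) (by norm_num) hn
            have h3 : (2 : ℝ) ^ M * (1 / 2) ^ M = 1 := by rw [← mul_pow]; norm_num
            have h4 : (0 : ℝ) < 2 ^ M := by positivity
            nlinarith
          · refine le_trans ?_ le_add_self
            rw [ENNReal.ofReal_natCast, mul_comm, ← div_eq_mul_inv,
              ENNReal.le_div_iff_mul_le (Or.inl (by positivity)) (Or.inl (by simp)), one_mul]
            exact_mod_cast hn
      _ = (4 * 2 ^ M : ℝ≥0∞) * δ t +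
            (M : ℝ≥0∞)⁻¹ * ∫⁻ ω in avoidRoot d T t,
              ENNReal.ofReal ((traj [] ω (T + t)).length : ℝ) ∂μ := by
          rw [lintegral_add_left ((hmeas fun w => ENNReal.ofReal ((1 / 2) ^ w.length / 4)).const_mul
              _), lintegral_const_mul _ (hmeas fun w => ENNReal.ofReal ((1 / 2) ^ w.length / 4)),
            lintegral_const_mul _ (hmeas fun w => ENNReal.ofReal (w.length : ℝ))]
      _ ≤ (4 * 2 ^ M : ℝ≥0∞) * δ t + (M : ℝ≥0∞)⁻¹ * T := by
          gcongr
          exact setLIntegral_length_le hd T t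
      _ = _ := by rw [mul_comm _ (T : ℝ≥0∞), div_eq_mul_inv]
  have hδ0 : Filter.Tendsto δ Filter.atTop (nhds 0) := by
    refine ENNReal.tendsto_atTop_zero_of_tsum_ne_top (ne_top_of_le_ne_top ENNReal.one_ne_top ?_)
    exact ENNReal.tsum_le_of_sum_range_le fun t => sum_setLIntegral_pow_le hd T t
  have hM : ∀ M : ℕ, 1 ≤ M → q ≤ T / M := by
    intro M hM
    have hlim : Filter.Tendsto (fun t => (4 * 2 ^ M : ℝ≥0∞) * δ t + T / M) Filter.atTop
        (nhds ((4 * 2 ^ M : ℝ≥0∞) * 0 + T / M)) :=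
      (ENNReal.Tendsto.const_mul hδ0 (Or.inr (by finiteness))).add tendsto_const_nhds
    rw [mul_zero, zero_add] at hlim
    exact ge_of_tendsto' hlim (hone M hM)
  have hlim : Filter.Tendsto (fun M : ℕ => (T : ℝ≥0∞) / M) Filter.atTop (nhds 0) := by
    simpa [div_eq_mul_inv] using ENNReal.Tendsto.const_mul (a := (T : ℝ≥0∞))
      ENNReal.tendsto_inv_nat_nhds_zero (Or.inr (by simp))
  exact le_antisymm (ge_of_tendsto hlim (Filter.eventually_atTop.2 ⟨1, hM⟩)) (zero_le)

end AvoidRoot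

/-- An event that holds almost surely has probability one. -/
theorem measure_eq_one_of_ae {Ω : Type} [MeasurableSpace Ω] {μ : Measure Ω}
    [IsProbabilityMeasure μ] {A : Set Ω} (h : ∀ᵐ ω ∂μ, ω ∈ A) : μ A = 1 := by
  refine le_antisymm prob_le_one ?_
  rw [← measure_univ (μ := μ)]
  exact measure_mono_ae (h.mono fun ω hω _ => hω)

theorem fmRecurrent_half {d : ℕ} (hd : 2 ≤ d) : FMRecurrent d (1 / 2) := by
  have := isProbabilityMeasure_fmStep hd (p := 1 / 2) (by norm_num) (by norm_num)
  have hprob : IsProbabilityMeasure (randomness d (fmStep d (1 / 2))) := by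
    unfold randomness; infer_instance
  have hmap : (randomness d (fmStep d (1 / 2))).map
      (fun ω (j : ℕ × Vertex d) => ω (([] : Vertex d), j)) = chainNoise (fmStep d (1 / 2)) :=
    Measure.map_infinitePi_infinitePi_of_inj
      (P := fun i : Vertex d × ℕ × Vertex d => fmStep d (1 / 2) i.2.2)
      (f := fun j : ℕ × Vertex d => (([] : Vertex d), j)) fun _ _ h => (Prod.mk.inj h).2
  have hae := ae_exists_traj_eq_nil hd
  rw [← hmap] at hae
  refine measure_eq_one_of_ae ?_
  have hmeas : Measurable fun (ω : Vertex d × ℕ × Vertex d → Vertex d) (j : ℕ × Vertex d) =>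
      ω (([] : Vertex d), j) := measurable_pi_lambda _ fun j => measurable_pi_apply _
  filter_upwards [ae_of_ae_map hmeas.aemeasurable hae] with ω hω
  refine rootVisits_eq_top_of_root fun T => ?_
  obtain ⟨k, hk, h⟩ := hω T
  exact ⟨k, hk, by rw [walk_eq_traj]; exact h⟩

/-! ### Comparison of the frogs that return to the root -/

noncomputable instance (d n : ℕ) : Fintype (treeBall d n) := Fintype.ofFinite _

/-- The vertices of a ball visited by a chain with positions `pos`. -/
def ballRange {d : ℕ} {S : Type} (pos : S → Option (Vertex d)) (n : ℕ) (s : S)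
    (ω : ℕ × S → S) : treeBall d n → Prop :=
  fun u => ∃ k, pos (traj s ω k) = some (u : Vertex d)

/-- Makes the events on balls increase with the radius, so that the probability of their union is a
supremum. -/
theorem manyReturns_mono {d m : ℕ} (R : Vertex d → Set (Vertex d)) :
    Monotone fun n => (fun f u : treeBall d n => (u : Vertex d) ∈ R f) ∈ manyReturns d n m := by
  intro n n' hn h
  have hsub : treeBall d n ⊆ treeBall d n' :=
    fun v (hv : v.length ≤ n) => show v.length ≤ n' from hv.trans hn
  refine le_trans h (Set.encard_le_encard fun f hf => ?_)
  have hmono : ∀ f u, u ∈ rangeOfRel (fun f u : treeBall d n => (u : Vertex d) ∈ R f) f →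
      u ∈ rangeOfRel (fun f u : treeBall d n' => (u : Vertex d) ∈ R f) f :=
    fun f u ⟨h1, h2, h3⟩ => ⟨hsub h1, hsub h2, h3⟩
  exact ⟨hf.1, hf.2.1.mono (fun f _ u _ => hmono f u) hsub (by simp [treeBall]),
    hmono _ _ hf.2.2⟩

theorem setOf_le_encard_returners {d : ℕ} {S : Type} (start : Vertex d → S) (pos : S → Option (Vertex d)) (m : ℕ) :
    {ω : Vertex d × ℕ × S → S | (m : ℕ∞) ≤
        (returners (fun f => {u | ∃ k, pos (walk start ω f k) = some u}) Set.univ).encard} =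
      ⋃ n, (fun ω (f : treeBall d n) => ballRange pos n (start f) fun j => ω ((f : Vertex d), j)) ⁻¹'
        manyReturns d n m := by
  ext ω
  have h := le_encard_returners_iff (fun f => {u | ∃ k, pos (walk start ω f k) = some u}) m
  refine h.trans ?_
  rw [Set.mem_iUnion]
  refine exists_congr fun n => ?_
  simp only [walk_eq_traj]
  rfl

section Returners

variable {d : ℕ} {S : Type} [MeasurableSpace S] [Countable S] [DiscreteMeasurableSpace S]

theorem measurable_ballRange (pos : S → Option (Vertex d)) (n : ℕ) (s : S) :
    Measurable (ballRange pos n s) := by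
  refine measurable_pi_lambda _ fun u => measurableSet_setOfPred.1 ?_
  have e : {ω : ℕ × S → S | ballRange pos n s ω u} =
      ⋃ k, (fun ω => traj s ω k) ⁻¹' {x | pos x = some (u : Vertex d)} := by
    ext ω
    rw [Set.mem_iUnion]
    rfl
  rw [e]
  exact MeasurableSet.iUnion fun k => measurable_traj s k MeasurableSet.of_discrete

theorem measurable_ballRange_pi (start : Vertex d → S) (pos : S → Option (Vertex d)) (n : ℕ) :
    Measurable fun (ω : Vertex d × ℕ × S → S) (f : treeBall d n) =>
      ballRange pos n (start f) fun j => ω ((f : Vertex d), j) :=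
  measurable_pi_lambda _ fun f => (measurable_ballRange pos n (start f)).comp
    (measurable_pi_lambda _ fun _ => measurable_pi_apply _)

theorem measurableSet_le_encard_returners (start : Vertex d → S) (pos : S → Option (Vertex d))
    (m : ℕ) : MeasurableSet {ω : Vertex d × ℕ × S → S | (m : ℕ∞) ≤
      (returners (fun f => {u | ∃ k, pos (walk start ω f k) = some u}) Set.univ).encard} := by
  rw [setOf_le_encard_returners]
  exact MeasurableSet.iUnion fun n => measurable_ballRange_pi start pos n MeasurableSet.of_discrete

/-- Only here are the frogs treated jointly: on each ball the ranges form a product measure on a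
finite space, to which coordinatewise domination applies. -/
theorem randomness_le_encard_returners (step : S → Measure S) [∀ x, IsProbabilityMeasure (step x)]
    (start : Vertex d → S) (pos : S → Option (Vertex d)) (m : ℕ) :
    randomness d step {ω | (m : ℕ∞) ≤
        (returners (fun f => {u | ∃ k, pos (walk start ω f k) = some u}) Set.univ).encard} =
      ⨆ n, Measure.pi (fun f : treeBall d n =>
        (chainNoise step).map (ballRange pos n (start f))) (manyReturns d n m) := by
  rw [setOf_le_encard_returners]
  have hmono : Monotone fun n => (fun (ω : Vertex d × ℕ × S → S) (f : treeBall d n) =>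
      ballRange pos n (start f) fun j => ω ((f : Vertex d), j)) ⁻¹' manyReturns d n m :=
    fun n n' hn ω hω =>
      manyReturns_mono (fun f => {u | ∃ k, pos (traj (start f) (fun j => ω (f, j)) k) = some u})
        hn hω
  rw [hmono.measure_iUnion]
  refine iSup_congr fun n => ?_
  rw [← randomness_map_pi step Subtype.val_injective
      fun f : treeBall d n => measurable_ballRange pos n (start f),
    Measure.map_apply (measurable_ballRange_pi start pos n) MeasurableSet.of_discrete]

end Returners

/-- Domination of the numbers of frogs that return to the root. -/
theorem randomness_returners_le {d : ℕ} (hd : 2 ≤ d) {p : ℝ} (h0 : 0 ≤ p) (h1 : p < 1 / 2)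
    (m : ℕ) :
    randomness d (nbStep d (p * (d - 1) / (d - (d + 1) * p))) {ω | (m : ℕ∞) ≤
        (returners (fun f => {u | ∃ k, (walk NBState.fresh ω f k).pos = some u})
          Set.univ).encard} ≤
      randomness d (fmStep d p) {ω | (m : ℕ∞) ≤
        (returners (fun f => {u | ∃ k, some (walk id ω f k) = some u}) Set.univ).encard} := by
  obtain ⟨hα0, hα1⟩ := pStar_mem hd h0 h1.le
  have := isProbabilityMeasure_fmStep hd h0 (p := p) (by linarith)
  have := isProbabilityMeasure_nbStep hd hα0 hα1
  have := isProbabilityMeasure_chainNoise (fmStep d p)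
  have := isProbabilityMeasure_chainNoise (nbStep d (p * (d - 1) / (d - (d + 1) * p)))
  rw [randomness_le_encard_returners _ NBState.fresh NBState.pos,
    randomness_le_encard_returners _ id some]
  refine iSup_mono fun n => ?_
  have hp1 : ∀ f : treeBall d n, IsProbabilityMeasure
      ((chainNoise (fmStep d p)).map (ballRange some n (id (f : Vertex d)))) := fun f =>
    Measure.isProbabilityMeasure_map (measurable_ballRange _ _ _).aemeasurable
  have hp2 : ∀ f : treeBall d n, IsProbabilityMeasure
      ((chainNoise (nbStep d (p * (d - 1) / (d - (d + 1) * p)))).map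
        (ballRange NBState.pos n (NBState.fresh (f : Vertex d)))) := fun f =>
    Measure.isProbabilityMeasure_map (measurable_ballRange _ _ _).aemeasurable
  refine pi_mono_of_isUpperSet (fun f U hU => ?_) (isUpperSet_manyReturns d n m)
  rw [Measure.map_apply (measurable_ballRange _ _ _) MeasurableSet.of_discrete,
    Measure.map_apply (measurable_ballRange _ _ _) MeasurableSet.of_discrete]
  -- An up-set of subsets of the ball pulls back to an increasing family of vertex sets that is
  -- local at level `n`, the form needed for one frog.
  have hV : IsUpperSet {A : Set (Vertex d) | (fun u : treeBall d n => (u : Vertex d) ∈ A) ∈ U} :=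
    fun A B hAB hA => hU (fun u hu => hAB hu) hA
  have hL : IsLocalFamily {A : Set (Vertex d) |
      (fun u : treeBall d n => (u : Vertex d) ∈ A) ∈ U} n := by
    intro A B hAB
    have e : (fun u : treeBall d n => (u : Vertex d) ∈ A) =
        fun u : treeBall d n => (u : Vertex d) ∈ B :=
      funext fun u => propext (hAB u u.2)
    change _ ∈ U ↔ _ ∈ U
    rw [e]
  have h := chainNoise_nbRange_le_fmRange hd h0 h1 hV hL (v := f) f.2
  refine h.trans (measure_mono fun ω hω => ?_)
  have e : ballRange some n (id (f : Vertex d)) ω =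
      fun u : treeBall d n => (u : Vertex d) ∈ {u | ∃ k, traj (f : Vertex d) ω k = u} :=
    funext fun u => propext (exists_congr fun k => by simp)
  change ballRange some n (id (f : Vertex d)) ω ∈ U
  rw [e]
  exact hω

/-! ### Visits of non-backtracking frogs to the root -/

/-- A non-backtracking frog visits the root at most once, and the frog of the root never returns. -/
theorem nb_visits_root {d : ℕ} {ω : ℕ × NBState d → NBState d}
    (hω : ∀ k s, NBNext s (ω (k, s))) (v : Vertex d) :
    (∀ k, (traj (.fresh []) ω (k + 1)).pos ≠ some []) ∧
      ∀ k l, (traj (.fresh v) ω k).pos = some [] → (traj (.fresh v) ω l).pos = some [] →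
        k = l := by
  have hroot : ∀ k, ∃ w, w ≠ [] ∧ traj (.fresh []) ω (k + 1) = .down w := by
    intro k
    induction k with
    | zero =>
      obtain ⟨i, hi⟩ := hω 0 (.fresh [])
      exact ⟨[i], by simp, hi⟩
    | succ k ih =>
      obtain ⟨w, -, hw⟩ := ih
      obtain ⟨i, hi⟩ := hω (k + 1) (.down w)
      exact ⟨i :: w, by simp, by rw [traj, hw, hi]⟩
  have h1 : ∀ k, (traj (.fresh []) ω (k + 1)).pos ≠ some [] := fun k => by
    obtain ⟨w, hw, h⟩ := hroot k
    rw [h]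
    simpa [NBState.pos] using hw
  refine ⟨h1, ?_⟩
  rcases eq_or_ne v [] with rfl | hv
  · intro k l hk hl
    cases k with
    | succ k => exact absurd hk (h1 k)
    | zero =>
      cases l with
      | succ l => exact absurd hl (h1 l)
      | zero => rfl
  -- Away from its start, such a frog can sit at the root only in an `up` state, and the following
  -- step removes it for good.
  · have hcase : ∀ k, traj (.fresh v) ω k = .fresh v ∨ (∃ w a, traj (.fresh v) ω k = .up w a) ∨
        (∃ w, w ≠ [] ∧ traj (.fresh v) ω k = .down w) ∨ traj (.fresh v) ω k = .gone := by
      intro k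
      induction k with
      | zero => exact Or.inl rfl
      | succ k ih =>
        have h := hω k (traj (.fresh v) ω k)
        rw [traj]
        set s' := ω (k, traj (.fresh v) ω k)
        right
        rcases ih with ih | ⟨w, a, ih⟩ | ⟨w, hw, ih⟩ | ih <;> rw [ih] at h
        · obtain ⟨a, w, rfl⟩ := List.exists_cons_of_ne_nil hv
          rcases h with h | ⟨i, h⟩
          · exact Or.inl ⟨_, _, h⟩
          · exact Or.inr (Or.inl ⟨_, by simp, h⟩)
        · rcases w with _ | ⟨b, w⟩
          · exact Or.inr (Or.inr h)
          · rcases h with h | ⟨i, -, h⟩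
            · exact Or.inl ⟨_, _, h⟩
            · exact Or.inr (Or.inl ⟨_, by simp, h⟩)
        · obtain ⟨i, h⟩ := h
          exact Or.inr (Or.inl ⟨_, by simp, h⟩)
        · exact Or.inr (Or.inr h)
    have hgone : ∀ k, (traj (.fresh v) ω k).pos = some [] →
        ∀ j, traj (.fresh v) ω (k + j + 1) = .gone := by
      intro k hk j
      induction j with
      | zero =>
        have h := hω k (traj (.fresh v) ω k)
        rcases hcase k with h' | ⟨w, a, h'⟩ | ⟨w, hw, h'⟩ | h' <;> rw [h'] at hk <;>
          simp [NBState.pos] at hk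
        · exact absurd hk hv
        · subst hk
          rw [h'] at h
          rw [add_zero, traj, h']
          exact h
        · exact absurd hk hw
      | succ j ih =>
        have h := hω (k + j + 1) (traj (.fresh v) ω (k + j + 1))
        rw [ih] at h
        rw [← add_assoc, traj, ih]
        exact h
    intro k l hk hl
    wlog hkl : k ≤ l generalizing k l
    · exact (this l k hl hk (by omega)).symm
    by_contra hne
    obtain ⟨j, rfl⟩ := Nat.exists_eq_add_of_lt (lt_of_le_of_ne hkl hne)
    rw [hgone k hk j] at hl
    simp [NBState.pos] at hl

theorem ae_randomness {d : ℕ} {S : Type} [MeasurableSpace S] [Countable S]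
    {step : S → Measure S} [∀ x, IsProbabilityMeasure (step x)] {N : S → S → Prop}
    (h : ∀ x, ∀ᵐ y ∂step x, N x y) :
    ∀ᵐ ω ∂randomness d step, ∀ f k x, N x (ω (f, k, x)) := by
  refine ae_all_iff.2 fun f => ae_all_iff.2 fun k => ae_all_iff.2 fun x => ?_
  exact (measurePreserving_eval_infinitePi (fun i : Vertex d × ℕ × S => step i.2.2)
    (f, k, x)).quasiMeasurePreserving.ae (h x)

/-- The two models are linked only through the events of having at least `m` returners, for each
finite `m`; recurrence gives them probability one in the non-backtracking model, and domination
transfers this. -/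
theorem fmRecurrent_of_sfmRecurrent {d : ℕ} (hd : 2 ≤ d) {p : ℝ} (h0 : 0 ≤ p) (h1 : p < 1 / 2)
    (hSFM : SFMRecurrent d (p * (d - 1) / (d - (d + 1) * p))) : FMRecurrent d p := by
  obtain ⟨hα0, hα1⟩ := pStar_mem hd h0 h1.le
  have := isProbabilityMeasure_fmStep hd h0 (p := p) (by linarith)
  have := isProbabilityMeasure_nbStep hd hα0 hα1
  have hprob : IsProbabilityMeasure (randomness d (fmStep d p)) := by
    unfold randomness; infer_instance
  have hae := ae_randomness (d := d) (ae_nbStep (d := d) (p * (d - 1) / (d - (d + 1) * p)))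
  have hfm : ∀ m : ℕ, ∀ᵐ ω ∂randomness d (fmStep d p), (m : ℕ∞) ≤
      (returners (fun f => {u | ∃ k, some (walk id ω f k) = some u}) Set.univ).encard := by
    intro m
    refine (prob_compl_eq_zero_iff (measurableSet_le_encard_returners id some m)).2
      (le_antisymm prob_le_one ?_)
    refine le_trans ?_ (randomness_returners_le hd h0 h1 m)
    rw [SFMRecurrent] at hSFM
    rw [← hSFM]
    -- Killing is discarded here. Monotonicity of outer measure suffices for the recurrence event,
    -- while the returner event is measurable.
    refine measure_mono_ae ?_
    filter_upwards [hae] with ω hω hvis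
    have hnb := fun f => nb_visits_root (ω := fun j => ω (f, j)) fun k s => hω f k s
    have e := encard_returners_eq_top (kill := sfmKill)
      (X := fun f k => (walk NBState.fresh ω f k).pos)
      (fun k => by rw [walk_eq_traj]; exact (hnb [] []).1 k)
      (fun f k l => by rw [walk_eq_traj, walk_eq_traj]; exact (hnb f f).2 k l) hvis
    exact le_top.trans e.ge
  refine measure_eq_one_of_ae ?_
  filter_upwards [ae_all_iff.2 hfm] with ω hω
  refine rootVisits_eq_top (fun f => rfl) ?_
  have e := ENat.eq_top_iff_forall_ge.2 hω
  simpa only [Option.some.injEq] using e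

/-- Let `d ≥ 2` and `0 ≤ p ≤ 1/2`. If `SFM(d, p*)` with `p* = p (d - 1) / (d - (d + 1) p)` is
recurrent, then `FM(d, p)` is recurrent. -/
theorem proposition1p3 (d : ℕ) (hd : 2 ≤ d) (p : ℝ) (hp0 : 0 ≤ p) (hp : p ≤ 1 / 2)
    (hSFM : SFMRecurrent d (p * (d - 1) / (d - (d + 1) * p))) : FMRecurrent d p := by
  rcases hp.lt_or_eq with h | rfl
  · exact fmRecurrent_of_sfmRecurrent hd hp0 h hSFM
  · exact fmRecurrent_half hd
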